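/- **Machine model.** Algorithms are programs of a random access machine whose memory cells hold natural numbers, with arithmetic ($+$, truncated $-$, $\cdot$, quotient, remainder), indirect addressing, conditionals, while-loops, subroutine calls (on a fresh memory) and, for randomized algorithms, an instruction that tosses a fair coin. Time is counted in bit operations: each instruction is charged for the bit lengths of the numbers and addresses it handles. A randomized algorithm is *zero-error* if on every input it halts with probability $1$ and its output is correct whenever it halts. A *Carmichael number* is a composite $n\ge 2$ with $a^n\equiv a \pmod n$ for all integers $a$. For large $x$ put $$L(x)=\exp\!\left(\frac{\log x\cdot\log\log\log x}{\log\log x}\right).$$ **Theorem.** 1. There is a zero-error randomized algorithm that, on input $B\in\mathbb N$, lists exactly the Carmichael numbers less than $B$ (possibly with repetitions), with the following property. If the question "is $n$ a Carmichael number?" can be decided by a zero-error randomized algorithm in expected time polynomial in $\log n$, then for each $\varepsilon>0$ there is a $B_0(\varepsilon)$ such that for all $B>B_0(\varepsilon)$ the expected running time on input $B$ is at most $B\cdot L(B)^{-1+\varepsilon}$; that is, the expected running time is at most $B\cdot L(B)^{-1+o(1)}$ as $B\to\infty$. 2. There is a deterministic algorithm that, on input $B\in\mathbb N$, lists exactly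 the Carmichael numbers less than $B$ (possibly with repetitions), with the following property. Suppose that the Extended Riemann Hypothesis (all zeros in $0<\operatorname{Re}s<1$ of Dirichlet $L$-functions have real part $1/2$) implies that the question "is $n$ a Carmichael number?" can be decided deterministically in time polynomial in $\log n$. Then, under the Extended Riemann Hypothesis, for each $\varepsilon>0$ there is a $B_0(\varepsilon)$ such that for all $B>B_0(\varepsilon)$ the running time on input $B$ is at most $B\cdot L(B)^{-1+\varepsilon}$, that is, at most $B\cdot L(B)^{-1+o(1)}$ as $B\to\infty$. The correctness of both algorithms is unconditional; only the running times are conditional. -/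

import Mathlib

open MeasureTheory
open scoped ENNReal

/-- A positive integer is a Carmichael number if it is composite and
`a ^ n ≡ a (mod n)` for all residues `a` modulo `n`. -/
def IsCarmichael (n : ℕ) : Prop :=
  1 < n ∧ ¬ n.Prime ∧ ∀ a : ZMod n, a ^ n = a

/-- `L x = exp (log x * log₃ x / log₂ x)`, with `log₂`, `log₃` the iterated natural logarithms. -/
noncomputable def carmichaelL (x : ℝ) : ℝ :=
  Real.exp (Real.log x * Real.log (Real.log (Real.log x)) / Real.log (Real.log x))

/-- The extended Riemann hypothesis: every zero of a Dirichlet L-function in the open critical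
strip lies on the critical line. -/
def ExtendedRiemannHypothesis : Prop :=
  ∀ (N : ℕ) [NeZero N] (χ : DirichletCharacter ℂ N) (s : ℂ),
    χ.LFunction s = 0 → 0 < s.re → s.re < 1 → s.re = 1 / 2

/-! ### Random access machine programs, with bit costs and coin flips -/

/-- The arithmetic instructions (subtraction is truncated, `/` and `%` are quotient and
remainder of natural numbers). -/
inductive ArithOp where
  | add | sub | mul | div | mod

def ArithOp.eval : ArithOp → ℕ → ℕ → ℕ
  | .add, a, b => a + b
  | .sub, a, b => a - b
  | .mul, a, b => a * b
  | .div, a, b => a / b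
  | .mod, a, b => a % b

/-- Programs of a random access machine. The memory consists of cells `0, 1, 2, …`, each holding
a natural number; below, `M[i]` is the content of cell `i`. -/
inductive RAMProg where
  /-- do nothing -/
  | skip
  /-- `M[i] := k` -/
  | const (i k : ℕ)
  /-- `M[i] := M[j] op M[k]` -/
  | arith (o : ArithOp) (i j k : ℕ)
  /-- `M[i] := M[M[j]]` -/
  | load (i j : ℕ)
  /-- `M[M[i]] := M[j]` -/
  | store (i j : ℕ)
  /-- `M[i] :=` a random bit, obtained by tossing a fair coin -/
  | flip (i : ℕ)
  /-- append `M[i]` to the list of printed numbers -/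
  | print (i : ℕ)
  /-- first `c`, then `d` -/
  | seq (c d : RAMProg)
  /-- if `M[i] ≠ 0` then `c` else `d` -/
  | ite (i : ℕ) (c d : RAMProg)
  /-- while `M[i] ≠ 0` do `c` -/
  | loop (i : ℕ) (c : RAMProg)
  /-- `M[i] := c(M[j])`: the subroutine `c` is run on input `M[j]` in a memory of its own,
  and only the value that it leaves in its cell `0` is returned -/
  | call (i : ℕ) (c : RAMProg) (j : ℕ)

namespace RAMProg

/-- A program is deterministic if it never tosses a coin. -/
def Deterministic : RAMProg → Prop
  | flip _ => False
  | seq c d => c.Deterministic ∧ d.Deterministic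
  | ite _ c d => c.Deterministic ∧ d.Deterministic
  | loop _ c => c.Deterministic
  | call _ c _ => c.Deterministic
  | _ => True

/-- The initial memory on input `n`: the input is in cell `0`, all other cells are zero. -/
def initMem (n : ℕ) : ℕ → ℕ := Function.update (fun _ => 0) 0 n

/-- `Exec c m ω m' ω' out t`: the program `c`, started with memory `m` and with the infinite
sequence `ω` of coin tosses to come, halts with memory `m'` and remaining coin tosses `ω'`, after
having printed the numbers in `out`, in time `t`. Time is counted in bit operations: an
instruction is charged for the bit lengths (`Nat.size`) of the numbers and of the computed
addresses that it handles; arithmetic is charged the product of the lengths of the operands,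
as in schoolbook arithmetic. -/
inductive Exec : RAMProg → (ℕ → ℕ) → (ℕ → Bool) → (ℕ → ℕ) → (ℕ → Bool) → List ℕ → ℕ → Prop
  | skip (m : ℕ → ℕ) (ω : ℕ → Bool) : Exec .skip m ω m ω [] 1
  | const (i k : ℕ) (m : ℕ → ℕ) (ω : ℕ → Bool) :
      Exec (.const i k) m ω (Function.update m i k) ω [] (k.size + 1)
  | arith (o : ArithOp) (i j k : ℕ) (m : ℕ → ℕ) (ω : ℕ → Bool) :
      Exec (.arith o i j k) m ω (Function.update m i (o.eval (m j) (m k))) ω []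
        (((m j).size + 1) * ((m k).size + 1))
  | load (i j : ℕ) (m : ℕ → ℕ) (ω : ℕ → Bool) :
      Exec (.load i j) m ω (Function.update m i (m (m j))) ω []
        ((m j).size + (m (m j)).size + 1)
  | store (i j : ℕ) (m : ℕ → ℕ) (ω : ℕ → Bool) :
      Exec (.store i j) m ω (Function.update m (m i) (m j)) ω []
        ((m i).size + (m j).size + 1)
  | flip (i : ℕ) (m : ℕ → ℕ) (ω : ℕ → Bool) :
      Exec (.flip i) m ω (Function.update m i (ω 0).toNat) (fun k => ω (k + 1)) [] 1
  | print (i : ℕ) (m : ℕ → ℕ) (ω : ℕ → Bool) :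
      Exec (.print i) m ω m ω [m i] ((m i).size + 1)
  | seq {c d : RAMProg} {m m₁ m₂ : ℕ → ℕ} {ω ω₁ ω₂ : ℕ → Bool} {out₁ out₂ : List ℕ} {t₁ t₂ : ℕ} :
      Exec c m ω m₁ ω₁ out₁ t₁ → Exec d m₁ ω₁ m₂ ω₂ out₂ t₂ →
      Exec (.seq c d) m ω m₂ ω₂ (out₁ ++ out₂) (t₁ + t₂)
  | ite_true {i : ℕ} {c d : RAMProg} {m m₁ : ℕ → ℕ} {ω ω₁ : ℕ → Bool} {out : List ℕ} {t : ℕ} :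
      m i ≠ 0 → Exec c m ω m₁ ω₁ out t →
      Exec (.ite i c d) m ω m₁ ω₁ out ((m i).size + 1 + t)
  | ite_false {i : ℕ} {c d : RAMProg} {m m₁ : ℕ → ℕ} {ω ω₁ : ℕ → Bool} {out : List ℕ} {t : ℕ} :
      m i = 0 → Exec d m ω m₁ ω₁ out t →
      Exec (.ite i c d) m ω m₁ ω₁ out ((m i).size + 1 + t)
  | loop_done {i : ℕ} {c : RAMProg} {m : ℕ → ℕ} {ω : ℕ → Bool} :
      m i = 0 → Exec (.loop i c) m ω m ω [] ((m i).size + 1)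
  | loop_step {i : ℕ} {c : RAMProg} {m m₁ m₂ : ℕ → ℕ} {ω ω₁ ω₂ : ℕ → Bool}
      {out₁ out₂ : List ℕ} {t₁ t₂ : ℕ} :
      m i ≠ 0 → Exec c m ω m₁ ω₁ out₁ t₁ → Exec (.loop i c) m₁ ω₁ m₂ ω₂ out₂ t₂ →
      Exec (.loop i c) m ω m₂ ω₂ (out₁ ++ out₂) ((m i).size + 1 + t₁ + t₂)
  | call {i j : ℕ} {c : RAMProg} {m m₁ : ℕ → ℕ} {ω ω₁ : ℕ → Bool} {out : List ℕ} {t : ℕ} :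
      Exec c (initMem (m j)) ω m₁ ω₁ out t →
      Exec (.call i c j) m ω (Function.update m i (m₁ 0)) ω₁ []
        ((m j).size + (m₁ 0).size + 1 + t)

/-- The law of an infinite sequence of independent fair coin tosses. -/
noncomputable def coinMeasure : Measure (ℕ → Bool) :=
  Measure.infinitePi fun _ : ℕ => (PMF.uniformOfFintype Bool).toMeasure

/-- The running time of `c` on input `n` with coin tosses `ω`; it is `∞` if `c` does not halt. -/
noncomputable def runTime (c : RAMProg) (n : ℕ) (ω : ℕ → Bool) : ℝ≥0∞ :=
  ⨅ (t : ℕ) (_ : ∃ m' ω' out, Exec c (initMem n) ω m' ω' out t), (t : ℝ≥0∞)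

/-- The expected running time of `c` on input `n`. -/
noncomputable def expectedTime (c : RAMProg) (n : ℕ) : ℝ≥0∞ :=
  ∫⁻ ω, c.runTime n ω ∂coinMeasure

/-- `c` decides "is `n` a Carmichael number?" without error: on every input it halts almost
surely, and whenever it halts, cell `0` contains `1` if the answer is yes and `0` if it is no. -/
def DecidesCarmichael (c : RAMProg) : Prop :=
  ∀ n : ℕ,
    (∀ᵐ ω ∂coinMeasure, ∃ m' ω' out t, Exec c (initMem n) ω m' ω' out t) ∧
    ∀ ω m' ω' out t, Exec c (initMem n) ω m' ω' out t →
      (IsCarmichael n → m' 0 = 1) ∧ (¬ IsCarmichael n → m' 0 = 0)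

/-- `c` lists the Carmichael numbers without error: on every input `B` it halts almost surely,
and whenever it halts, the printed numbers are precisely the Carmichael numbers below `B`. -/
def ListsCarmichael (c : RAMProg) : Prop :=
  ∀ B : ℕ,
    (∀ᵐ ω ∂coinMeasure, ∃ m' ω' out t, Exec c (initMem B) ω m' ω' out t) ∧
    ∀ ω m' ω' out t, Exec c (initMem B) ω m' ω' out t →
      ∀ n : ℕ, n ∈ out ↔ IsCarmichael n ∧ n < B

end RAMProg

/-- "Is `n` a Carmichael number?" is decidable in zero-error probabilistic polynomial time
(expected time polynomial in the bit length of `n`). -/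
def CarmichaelInZPP : Prop :=
  ∃ c : RAMProg, c.DecidesCarmichael ∧
    ∃ K k : ℕ, ∀ n : ℕ, c.expectedTime n ≤ ((K * (n.size + 1) ^ k : ℕ) : ℝ≥0∞)

/-- "Is `n` a Carmichael number?" is decidable in deterministic polynomial time. -/
def CarmichaelInP : Prop :=
  ∃ c : RAMProg, c.Deterministic ∧ c.DecidesCarmichael ∧
    ∃ K k : ℕ, ∀ (n : ℕ) (ω : ℕ → Bool), c.runTime n ω ≤ ((K * (n.size + 1) ^ k : ℕ) : ℝ≥0∞)

open MeasureTheory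
open scoped ENNReal

/-! One deterministic program, with a time bound valid for every coin sequence, serves both parts.

Write `λ(a)` for `predLcm a`, the lcm of `p - 1` over the primes `p ∣ a` (0 if `a` is not
squarefree). By Korselt's criterion (`isCarmichael_iff`), a composite `n` is Carmichael iff `λ(n) ∣
n - 1`. Put `T = threshold B`, about `L(B) ^ (1 - o(1))`, and `D = B / T + 1`. A sieve tabulates
`λ(a)` for `a ≤ D`, which settles all `n ≤ D`. A Carmichael `n = d * b` with `D < n < B` can be
chosen with `2 ≤ d ≤ D`, `2 ≤ b` and either `T ≤ λ(d)` or `D < d * T`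
(`IsCarmichael.exists_divisor`): a prime factor above `T` is such a `d`, and otherwise the largest
divisor up to `D` is one. For such `d` the cofactor also satisfies `b ≤ D` (`cofactor_le`), so
`λ(b)` is in the table and `n` is tested without factoring. Moreover `d * b ≡ 1` modulo `λ(d)`
leaves one residue class for `b`, that is, about `B / (d * λ(d))` candidates.

Up to powers of `log B` the time is thus `D + B * ∑ 1 / (d * λ(d))` over these `d`. Those with `T ≤
λ(d)` contribute `O(log B / T)`. Those with `d > z = D / T` are handled by Rankin's method
(`sum_inv_mul_predLcm_le`): `1 / d ≤ z ^ (-s) * d ^ (s - 1)`, and the sum of `d ^ (s - 1)` over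
`λ(d) = f` is at most a double exponential of `∑ q ^ (s - 1)` over primes `q ∣ f`, because every
prime of `d` is one more than a divisor of `f`. With `s` slightly below `log₃ B / log₂ B` (iterated
logarithms), that factor is `L(B) ^ o(1)`, while `z ^ (-s) = L(B) ^ (-1 + o(1))`.

On the machine, all operands stay below `opBound B`, so an instruction costs `O((log B) ^ 2)` bit
operations and it suffices to count instructions; `Tri` is the Hoare logic for this. -/

namespace RAMProg

/-! ### A Hoare logic with instruction counts. -/

/-- Executions are deterministic once the coin tosses are fixed. -/
theorem Exec.unique {c : RAMProg} {m m₁ m₂ : ℕ → ℕ} {ω ω₁ ω₂ : ℕ → Bool} {o₁ o₂ : List ℕ}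
    {t₁ t₂ : ℕ} (h₁ : Exec c m ω m₁ ω₁ o₁ t₁) (h₂ : Exec c m ω m₂ ω₂ o₂ t₂) :
    m₁ = m₂ ∧ ω₁ = ω₂ ∧ o₁ = o₂ ∧ t₁ = t₂ := by
  induction h₁ generalizing m₂ ω₂ o₂ t₂ with
  | seq _ _ ih₁ ih₂ =>
    cases h₂ with
    | seq a b =>
      obtain ⟨rfl, rfl, rfl, rfl⟩ := ih₁ a
      obtain ⟨rfl, rfl, rfl, rfl⟩ := ih₂ b
      simp
  | ite_true h _ ih =>
    cases h₂ with
    | ite_true _ a =>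
      obtain ⟨rfl, rfl, rfl, rfl⟩ := ih a
      simp
    | ite_false h' _ => exact absurd h' h
  | ite_false h _ ih =>
    cases h₂ with
    | ite_true h' _ => exact absurd h h'
    | ite_false _ a =>
      obtain ⟨rfl, rfl, rfl, rfl⟩ := ih a
      simp
  | loop_done h =>
    cases h₂ with
    | loop_done _ => simp
    | loop_step h' _ _ => exact absurd h h'
  | loop_step h _ _ ih₁ ih₂ =>
    cases h₂ with
    | loop_done h' => exact absurd h' h
    | loop_step _ a b =>
      obtain ⟨rfl, rfl, rfl, rfl⟩ := ih₁ a
      obtain ⟨rfl, rfl, rfl, rfl⟩ := ih₂ b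
      simp
  | call _ ih =>
    cases h₂ with
    | call a =>
      obtain ⟨rfl, rfl, rfl, rfl⟩ := ih a
      simp
  | _ => cases h₂; simp

/-- `Tri N c m o k P`: started in memory `m` after having printed `o`, the program `c` halts
without tossing a coin, within `k` steps of the cost of an instruction on operands that are at
most `N`, in a memory and with an output that satisfy `P`. -/
def Tri (N : ℕ) (c : RAMProg) (m : ℕ → ℕ) (o : List ℕ) (k : ℕ)
    (P : (ℕ → ℕ) → List ℕ → Prop) : Prop :=
  ∃ m' out t, (∀ ω, Exec c m ω m' ω out t) ∧ t ≤ k * (N.size + 1) ^ 2 ∧ P m' (o ++ out)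

namespace Tri

variable {N : ℕ} {c d : RAMProg} {m : ℕ → ℕ} {o : List ℕ} {k k₁ k₂ : ℕ}
  {P R : (ℕ → ℕ) → List ℕ → Prop}

theorem mono (h : Tri N c m o k₁ P) (hk : k₁ ≤ k₂) (hP : ∀ m o, P m o → R m o) :
    Tri N c m o k₂ R := by
  obtain ⟨m', out, t, h1, h2, h3⟩ := h
  exact ⟨m', out, t, h1, h2.trans (Nat.mul_le_mul_right _ hk), hP _ _ h3⟩

theorem skip (h : P m o) : Tri N .skip m o 1 P :=
  ⟨m, [], 1, fun ω => .skip m ω, by nlinarith [Nat.zero_le N.size], by simpa using h⟩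

theorem const {i v : ℕ} (hv : v ≤ N) (h : P (Function.update m i v) o) :
    Tri N (.const i v) m o 1 P :=
  ⟨_, [], _, fun ω => .const i v m ω, by
    have := Nat.size_le_size hv
    nlinarith [Nat.zero_le N.size], by simpa using h⟩

theorem arith {a : ArithOp} {i x y : ℕ} (hx : m x ≤ N) (hy : m y ≤ N)
    (h : P (Function.update m i (a.eval (m x) (m y))) o) : Tri N (.arith a i x y) m o 1 P :=
  ⟨_, [], _, fun ω => .arith a i x y m ω, by
    have h1 := Nat.size_le_size hx
    have h2 := Nat.size_le_size hy
    rw [one_mul, sq]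
    exact Nat.mul_le_mul (by lia) (by lia), by simpa using h⟩

theorem load {i x : ℕ} (hx : m x ≤ N) (hy : m (m x) ≤ N)
    (h : P (Function.update m i (m (m x))) o) : Tri N (.load i x) m o 1 P :=
  ⟨_, [], _, fun ω => .load i x m ω, by
    have h1 := Nat.size_le_size hx
    have h2 := Nat.size_le_size hy
    nlinarith [Nat.zero_le N.size], by simpa using h⟩

theorem store {i x : ℕ} (hx : m i ≤ N) (hy : m x ≤ N)
    (h : P (Function.update m (m i) (m x)) o) : Tri N (.store i x) m o 1 P :=
  ⟨_, [], _, fun ω => .store i x m ω, by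
    have h1 := Nat.size_le_size hx
    have h2 := Nat.size_le_size hy
    nlinarith [Nat.zero_le N.size], by simpa using h⟩

theorem print {i : ℕ} (hx : m i ≤ N) (h : P m (o ++ [m i])) : Tri N (.print i) m o 1 P :=
  ⟨_, _, _, fun ω => .print i m ω, by
    have h1 := Nat.size_le_size hx
    nlinarith [Nat.zero_le N.size], h⟩

theorem seq (h : Tri N c m o k₁ fun m' o' => Tri N d m' o' k₂ P) :
    Tri N (.seq c d) m o (k₁ + k₂) P := by
  obtain ⟨m', out, t, h1, h2, m'', out', t', h3, h4, h5⟩ := h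
  exact ⟨m'', out ++ out', t + t', fun ω => (h1 ω).seq (h3 ω), by nlinarith, by simpa using h5⟩

theorem ite {i : ℕ} (hi : m i ≤ N) (h₁ : m i ≠ 0 → Tri N c m o k P)
    (h₂ : m i = 0 → Tri N d m o k P) : Tri N (.ite i c d) m o (k + 1) P := by
  have hs := Nat.size_le_size hi
  by_cases h : m i = 0
  · obtain ⟨m', out, t, h1, h2, h3⟩ := h₂ h
    exact ⟨m', out, _, fun ω => .ite_false h (h1 ω), by nlinarith, h3⟩
  · obtain ⟨m', out, t, h1, h2, h3⟩ := h₁ h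
    exact ⟨m', out, _, fun ω => .ite_true h (h1 ω), by nlinarith, h3⟩

/-- The rule for loops; `I b m o` is an invariant, in which `b` bounds the time that is left. -/
theorem loop {i : ℕ} (I : ℕ → (ℕ → ℕ) → List ℕ → Prop)
    (h0 : ∀ b m o, I b m o → m i ≤ N ∧ 1 ≤ b)
    (h1 : ∀ b m o, I b m o → m i = 0 → P m o)
    (h2 : ∀ b m o, I b m o → m i ≠ 0 →
      ∃ k b', b' + k + 1 ≤ b ∧ Tri N c m o k (I b'))
    (h : I k m o) : Tri N (.loop i c) m o k P := by
  induction k using Nat.strong_induction_on generalizing m o with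
  | _ k ih =>
    have hs := Nat.size_le_size (h0 _ _ _ h).1
    by_cases hm : m i = 0
    · refine ⟨m, [], _, fun ω => .loop_done hm, ?_, by simpa using h1 _ _ _ h hm⟩
      nlinarith [(h0 _ _ _ h).2]
    · obtain ⟨k', b', hb, m', out, t, e1, e2, e3⟩ := h2 _ _ _ h hm
      obtain ⟨m'', out', t', f1, f2, f3⟩ := ih b' (by lia) e3
      refine ⟨m'', out ++ out', _, fun ω => .loop_step hm (e1 ω) (f1 ω), ?_, by simpa using f3⟩
      have : (b' + k' + 1) * (N.size + 1) ^ 2 ≤ k * (N.size + 1) ^ 2 := Nat.mul_le_mul_right _ hb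
      nlinarith

theorem call {i j : ℕ} (hj : m j ≤ N)
    (h : Tri N c (initMem (m j)) [] k
      fun m' _ => m' 0 ≤ N ∧ P (Function.update m i (m' 0)) o) :
    Tri N (.call i c j) m o (k + 1) P := by
  obtain ⟨m', out, t, h1, h2, h3, h4⟩ := h
  have hs := Nat.size_le_size hj
  have hs' := Nat.size_le_size h3
  exact ⟨_, [], _, fun ω => .call (h1 ω), by nlinarith, by simpa using h4⟩

end Tri

end RAMProg

namespace RAMProg

namespace Tri

variable {N : ℕ} {c d : RAMProg} {m : ℕ → ℕ} {o : List ℕ} {k k₁ k₂ : ℕ}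
  {P : (ℕ → ℕ) → List ℕ → Prop}

theorem const_seq {i v : ℕ} (hv : v ≤ N) (h : Tri N d (Function.update m i v) o k P) :
    Tri N (.seq (.const i v) d) m o (1 + k) P :=
  .seq (.const hv h)

theorem arith_seq {a : ArithOp} {i x y : ℕ} (hx : m x ≤ N) (hy : m y ≤ N)
    (h : Tri N d (Function.update m i (a.eval (m x) (m y))) o k P) :
    Tri N (.seq (.arith a i x y) d) m o (1 + k) P :=
  .seq (.arith hx hy h)

theorem load_seq {i x : ℕ} (hx : m x ≤ N) (hy : m (m x) ≤ N)
    (h : Tri N d (Function.update m i (m (m x))) o k P) :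
    Tri N (.seq (.load i x) d) m o (1 + k) P :=
  .seq (.load hx hy h)

theorem store_seq {i x : ℕ} (hx : m i ≤ N) (hy : m x ≤ N)
    (h : Tri N d (Function.update m (m i) (m x)) o k P) :
    Tri N (.seq (.store i x) d) m o (1 + k) P :=
  .seq (.store hx hy h)

theorem ite_add {i : ℕ} (hi : m i ≤ N) (h₁ : m i ≠ 0 → Tri N c m o k₁ P)
    (h₂ : m i = 0 → Tri N d m o k₂ P) : Tri N (.ite i c d) m o (k₁ + k₂ + 1) P :=
  .ite hi (fun h => (h₁ h).mono (by lia) fun _ _ => id)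
    fun h => (h₂ h).mono (by lia) fun _ _ => id

end Tri

/-! ### Bit lengths and the threshold. -/

/-- The bit length of the input. -/
def sizeProg : RAMProg :=
  .seq (.const 2 2) <| .seq (.const 3 1) <| .seq
    (.loop 0 <| .seq (.arith .div 0 0 2) (.arith .add 1 1 3))
    (.arith .add 0 1 4)

theorem size_div_two_add_one {n : ℕ} (h : n ≠ 0) : (n / 2).size + 1 = n.size := by
  apply le_antisymm
  · rw [Nat.succ_le_iff, Nat.lt_size]
    rcases Nat.eq_zero_or_pos (n / 2) with h' | h'
    · simp [h', Nat.one_le_iff_ne_zero.2 h]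
    · have h1 : (n / 2).size - 1 < (n / 2).size := Nat.sub_lt (Nat.size_pos.2 h') one_pos
      have h2 := Nat.lt_size.1 h1
      have h3 : 2 ^ (n / 2).size = 2 ^ ((n / 2).size - 1) * 2 := by
        rw [← pow_succ]; congr 1; lia
      lia
  · rw [Nat.size_le, pow_succ]
    have := Nat.lt_size_self (n / 2)
    lia

theorem sizeProg_spec {N n : ℕ} (hn : n ≤ N) (hN : 2 ≤ N) :
    Tri N sizeProg (initMem n) [] (3 * N.size + 4) fun m _ => m 0 = n.size := by
  have hsize : n.size ≤ n := Nat.size_le.2 Nat.lt_two_pow_self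
  have hsN := Nat.size_le_size hn
  refine Tri.mono (Tri.const_seq hN <| Tri.const_seq (by lia) <| Tri.seq <|
    Tri.loop (k := 3 * N.size + 1)
    (fun b m _ => m 0 ≤ N ∧ 3 * (m 0).size + 1 ≤ b ∧ (m 0).size + m 1 = n.size ∧
      m 2 = 2 ∧ m 3 = 1 ∧ m 4 = 0) ?_ ?_ ?_ ?_) (k₁ := 1 + (1 + (3 * N.size + 1 + 1)))
      (by lia) (fun _ _ => id)
  · rintro b m o ⟨h1, h2, -⟩
    exact ⟨h1, by lia⟩
  · rintro b m o ⟨h1, h2, h3, h4, h5, h6⟩ h0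
    -- Cell 4 is never written, so adding it is a plain copy.
    refine Tri.arith (by lia) (by lia) ?_
    simp_all [ArithOp.eval]
  · rintro b m o ⟨h1, h2, h3, h4, h5, h6⟩ h0
    have := size_div_two_add_one h0
    refine ⟨2, b - 3, by lia, Tri.arith_seq (by lia) (by lia) <| Tri.arith ?_ ?_ ?_⟩
    all_goals simp [ArithOp.eval, *]
    all_goals lia
  · simp [initMem]
    lia

end RAMProg

/-- The exponent of `threshold`. -/
def thresholdExp (B : ℕ) : ℕ :=
  B.size * B.size.size.size / (B.size.size + 4 * B.size.size.size)

/-- A power of two of the size `carmichaelL B ^ (1 + o(1))`. -/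
def threshold (B : ℕ) : ℕ := 2 ^ thresholdExp B

/-- The summand `4 * B.size.size.size` in the denominator of `thresholdExp` is there for this bound,
valid for every `B`; asymptotically it is negligible against `B.size.size`. -/
theorem four_mul_thresholdExp_le (B : ℕ) : 4 * thresholdExp B ≤ B.size := by
  unfold thresholdExp
  rcases Nat.eq_zero_or_pos B.size.size.size with h | h
  · simp [h]
  · have : B.size * B.size.size.size / (B.size.size + 4 * B.size.size.size) ≤
        B.size * B.size.size.size / (4 * B.size.size.size) :=
      Nat.div_le_div_left (by lia) (by lia)
    rw [Nat.mul_div_mul_right _ _ h] at this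
    lia

/-- The cube gives `T ^ 2 ≤ B / T`, which makes cofactors fit into the table. -/
theorem threshold_pow_three_le {B : ℕ} (hB : B ≠ 0) : threshold B ^ 3 ≤ B := by
  have h1 := four_mul_thresholdExp_le B
  have h2 : 0 < B.size := Nat.size_pos.2 (Nat.pos_of_ne_zero hB)
  rw [threshold, ← pow_mul]
  exact Nat.lt_size.1 (by lia)

theorem threshold_pos (B : ℕ) : 0 < threshold B := by simp [threshold]

theorem threshold_le (B : ℕ) : threshold B ≤ B + 1 := by
  rcases eq_or_ne B 0 with rfl | hB
  · simp [threshold, thresholdExp]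
  · exact (Nat.le_self_pow three_ne_zero _).trans ((threshold_pow_three_le hB).trans (by lia))

namespace RAMProg

/-- Computation of `threshold`. -/
def thresholdProg : RAMProg :=
  .seq (.call 1 sizeProg 0) <| .seq (.call 2 sizeProg 1) <| .seq (.call 3 sizeProg 2) <|
  .seq (.const 4 4) <| .seq (.const 7 1) <| .seq (.const 8 2) <| .seq (.const 0 1) <|
  .seq (.arith .mul 5 4 3) <| .seq (.arith .add 5 2 5) <| .seq (.arith .mul 6 1 3) <|
  .seq (.arith .div 6 6 5) <| .loop 6 <| .seq (.arith .mul 0 0 8) (.arith .sub 6 6 7)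

theorem Tri.call_sizeProg {N : ℕ} {m : ℕ → ℕ} {o : List ℕ} {i j : ℕ}
    {P : (ℕ → ℕ) → List ℕ → Prop} (hj : m j ≤ N) (hN : 2 ≤ N)
    (h : P (Function.update m i (m j).size) o) :
    Tri N (.call i sizeProg j) m o (3 * N.size + 5) P :=
  .call hj <| (sizeProg_spec hj hN).mono le_rfl fun m' _ h' => by
    rw [h']
    exact ⟨(Nat.size_le.2 Nat.lt_two_pow_self).trans hj, h⟩

theorem thresholdProg_spec {N B : ℕ} (hN : (B + 5) ^ 2 ≤ N) :
    Tri N thresholdProg (initMem B) [] (12 * N.size + 24) fun m _ => m 0 = threshold B := by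
  have s1 : B.size ≤ B := Nat.size_le.2 Nat.lt_two_pow_self
  have s2 : B.size.size ≤ B.size := Nat.size_le.2 Nat.lt_two_pow_self
  have s3 : B.size.size.size ≤ B.size.size := Nat.size_le.2 Nat.lt_two_pow_self
  have h4 := four_mul_thresholdExp_le B
  have hT := threshold_le B
  have hBN : B + 5 ≤ N := (Nat.le_self_pow two_ne_zero _).trans hN
  have hmul : B.size * B.size.size.size ≤ N :=
    (Nat.mul_le_mul s1 (s3.trans (s2.trans s1))).trans (by nlinarith)
  have h5 : B.size.size + 4 * B.size.size.size ≤ N := by nlinarith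
  have hNs : B.size ≤ N.size := Nat.size_le_size (by lia)
  refine Tri.mono (k₁ := (3 * N.size + 5) + ((3 * N.size + 5) + ((3 * N.size + 5) +
    (1 + (1 + (1 + (1 + (1 + (1 + (1 + (1 + (3 * thresholdExp B + 1))))))))))))
    (Tri.seq <| Tri.call_sizeProg ?_ ?_ <| Tri.seq <| Tri.call_sizeProg ?_ ?_ <| Tri.seq <|
      Tri.call_sizeProg ?_ ?_ <| Tri.const_seq ?_ <| Tri.const_seq ?_ <| Tri.const_seq ?_ <|
      Tri.const_seq ?_ <| Tri.arith_seq ?_ ?_ <| Tri.arith_seq ?_ ?_ <| Tri.arith_seq ?_ ?_ <|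
      Tri.arith_seq ?_ ?_ <| Tri.loop
        -- Cell 6 counts the doublings of cell 0 that are still to be done.
        (fun b m _ => m 0 * 2 ^ m 6 = threshold B ∧ 3 * m 6 + 1 ≤ b ∧ m 6 ≤ B ∧ m 7 = 1 ∧ m 8 = 2)
        ?bound ?exit ?step ?init) (by lia) (fun _ _ => id)
  case bound =>
    rintro b m o ⟨h1, h2, h3, -⟩
    exact ⟨by lia, by lia⟩
  case exit =>
    rintro b m o ⟨h1, h2, h3, -⟩ h0
    simpa [h0] using h1
  case step =>
    rintro b m o ⟨h1, h2, h3, h7, h8⟩ h0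
    have h9 : m 0 ≤ N :=
      (Nat.le_mul_of_pos_right _ (Nat.two_pow_pos (m 6))).trans (by lia)
    refine ⟨2, b - 3, by lia, Tri.arith_seq h9 (by lia) <| Tri.arith ?_ ?_ ⟨?_, ?_⟩⟩
    all_goals simp [ArithOp.eval, *]
    · lia
    · lia
    · obtain ⟨e, he⟩ := Nat.exists_eq_succ_of_ne_zero h0
      rw [← h1, he, Nat.succ_sub_one, pow_succ]
      ring
    · lia
  case init =>
    simp [initMem, ArithOp.eval, threshold]
    have : thresholdExp B = B.size * B.size.size.size / (B.size.size + 4 * B.size.size.size) := rfl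
    rw [← this]
    simp
    lia
  all_goals try simp [initMem, ArithOp.eval]
  all_goals lia

/-! ### The extended Euclidean algorithm. -/

/-- From `a ≥ b + a % b` and `a % b < b` one gets `2 * (a % b) ≤ a`. So the product of the two
current remainders loses a bit per Euclidean step, which bounds the number of steps. -/
theorem size_mul_mod_lt {a b : ℕ} (hb : b ≠ 0) (h : b < a) :
    (b * (a % b)).size + 1 ≤ (a * b).size := by
  rw [← size_div_two_add_one (mul_ne_zero (by lia) hb)]
  refine Nat.succ_le_succ (Nat.size_le_size ?_)
  rw [Nat.le_div_iff_mul_le two_pos, mul_assoc, mul_comm]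
  refine Nat.mul_le_mul_right _ ?_
  have h1 := Nat.div_add_mod a b
  have h2 := Nat.mod_lt a (Nat.pos_of_ne_zero hb)
  have h3 : 1 ≤ a / b := (Nat.one_le_div_iff (Nat.pos_of_ne_zero hb)).2 h.le
  nlinarith

/-- Bézout coefficients are kept modulo `y`, since cells hold no negative numbers; `y - q * s₁ % y`
stands for `-q * s₁`. -/
theorem euclid_step_modEq {x y r₀ r₁ s₀ s₁ : ℕ} (hy : 0 < y) (h₀ : s₀ * x ≡ r₀ [MOD y])
    (h₁ : s₁ * x ≡ r₁ [MOD y]) :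
    (s₀ + (y - r₀ / r₁ * s₁ % y)) % y * x ≡ r₀ % r₁ [MOD y] := by
  rw [← ZMod.natCast_eq_natCast_iff] at *
  have h2 : ((r₁ * (r₀ / r₁) + r₀ % r₁ : ℕ) : ZMod y) = r₀ := by rw [Nat.div_add_mod]
  have h3 : ((y - r₀ / r₁ * s₁ % y : ℕ) : ZMod y) = -((r₀ / r₁ : ℕ) * s₁) := by
    rw [Nat.cast_sub (Nat.mod_lt _ hy).le]
    simp
  push_cast at *
  rw [ZMod.natCast_mod, Nat.cast_add, h3]
  linear_combination h₀ - (r₀ / r₁ : ℕ) * h₁ - h2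

/-- The invariant of the loop of `euclid`, with `b` a bound for the time that is left. -/
structure EuclidInv (m₀ : ℕ → ℕ) (o₀ : List ℕ) (x y b : ℕ) (m : ℕ → ℕ) (o : List ℕ) : Prop where
  time : 11 * (m 1 * m 2).size + 1 ≤ b
  modulus : m 3 = y
  lt₀ : m 4 < y
  lt₁ : m 5 < y
  lt : m 2 < m 1
  le : m 1 ≤ y
  gcd : (m 1).gcd (m 2) = x.gcd y
  modEq₀ : m 4 * x ≡ m 1 [MOD y]
  modEq₁ : m 5 * x ≡ m 2 [MOD y]
  out : o = o₀
  frame : ∀ i, 7 < i → m i = m₀ i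

/-- The body of the loop of `euclid`. -/
def euclidStep : RAMProg :=
  .seq (.arith .div 6 1 2) <| .seq (.arith .mod 7 1 2) <| .seq (.arith .add 1 2 8) <|
  .seq (.arith .add 2 7 8) <| .seq (.arith .mul 7 6 5) <| .seq (.arith .mod 7 7 3) <|
  .seq (.arith .sub 7 3 7) <| .seq (.arith .add 7 4 7) <| .seq (.arith .add 4 5 8) <|
  .arith .mod 5 7 3

/-- The Euclidean algorithm for the contents `x`, `y` of the cells `1`, `2`: it leaves `gcd x y` in
cell `1` and in cell `4` an `s < y` with `s * x ≡ gcd x y` modulo `y`. The cells `8` and `9`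
must contain `0` and `1`. -/
def euclid : RAMProg :=
  .seq (.arith .add 3 2 8) <| .seq (.arith .mod 6 1 2) <| .seq (.arith .add 1 2 8) <|
  .seq (.arith .add 2 6 8) <| .seq (.arith .add 4 8 8) <| .seq (.arith .mod 5 9 3) <|
  .loop 2 euclidStep

theorem euclidStep_spec {N x y b : ℕ} {m₀ m : ℕ → ℕ} {o₀ o : List ℕ}
    (hyN : (y + 1) ^ 2 ≤ N) (h8 : m₀ 8 = 0) (h : EuclidInv m₀ o₀ x y b m o) (h0 : m 2 ≠ 0) :
    Tri N euclidStep m o 10 (EuclidInv m₀ o₀ x y (b - 11)) := by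
  obtain ⟨h1, h2, h3, h4, h5, h6, hg, hs₀, hs₁, ho, hf⟩ := h
  have e8 : m 8 = 0 := (hf 8 (by lia)).trans h8
  have hsz := size_mul_mod_lt h0 h5
  have hy : 0 < y := by lia
  have hq : m 1 / m 2 ≤ y := (Nat.div_le_self _ _).trans h6
  have hr : m 1 % m 2 < m 2 := Nat.mod_lt _ (Nat.pos_of_ne_zero h0)
  have ht : m 1 / m 2 * m 5 % y < y := Nat.mod_lt _ hy
  have hqs : m 1 / m 2 * m 5 ≤ N := (Nat.mul_le_mul hq h4.le).trans (by nlinarith)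
  have hyN' : 2 * y ≤ N := by nlinarith
  refine Tri.mono (k₁ := 1 + (1 + (1 + (1 + (1 + (1 + (1 + (1 + (1 + 1)))))))))
    (Tri.arith_seq ?_ ?_ <| Tri.arith_seq ?_ ?_ <| Tri.arith_seq ?_ ?_ <|
    Tri.arith_seq ?_ ?_ <| Tri.arith_seq ?_ ?_ <| Tri.arith_seq ?_ ?_ <| Tri.arith_seq ?_ ?_ <|
    Tri.arith_seq ?_ ?_ <| Tri.arith_seq ?_ ?_ <| Tri.arith ?_ ?_
      (P := EuclidInv m₀ o₀ x y (b - 11)) ?post) (by lia) (fun _ _ => id)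
  case post =>
    have hmod := euclid_step_modEq hy hs₀ hs₁
    have hgcd : (m 2).gcd (m 1 % m 2) = x.gcd y := by
      rw [Nat.gcd_comm, ← Nat.gcd_rec, Nat.gcd_comm, hg]
    constructor
    case frame =>
      intro i hi
      rw [← hf i hi]
      simp [show i ≠ 1 by lia, show i ≠ 2 by lia, show i ≠ 4 by lia, show i ≠ 5 by lia,
        show i ≠ 6 by lia, show i ≠ 7 by lia]
    case out => exact ho
    all_goals simp [ArithOp.eval, h2, e8, hgcd, h4, hr, hs₁, hmod, Nat.mod_lt _ hy]
    all_goals lia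
  all_goals try simp [ArithOp.eval, e8, h2]
  all_goals lia

theorem euclid_spec {N : ℕ} {m : ℕ → ℕ} {o : List ℕ} (hx : m 1 ≤ N) (hy : 0 < m 2)
    (hyN : (m 2 + 1) ^ 2 ≤ N) (h8 : m 8 = 0) (h9 : m 9 = 1) :
    Tri N euclid m o (11 * N.size + 7) fun m' o' =>
      o' = o ∧ m' 1 = Nat.gcd (m 1) (m 2) ∧ m' 4 < m 2 ∧
      m' 4 * m 1 ≡ Nat.gcd (m 1) (m 2) [MOD m 2] ∧ ∀ i, 7 < i → m' i = m i := by
  generalize hX : m 1 = x at *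
  generalize hY : m 2 = y at *
  have hmod : x % y < y := Nat.mod_lt _ hy
  -- The coefficient starts as `1 % y` instead of 1, so that it is below `y` also when `y = 1`.
  have hmod' : 1 % y < y := Nat.mod_lt _ hy
  have hyN' : y ≤ N := by nlinarith
  refine Tri.mono (k₁ := 1 + (1 + (1 + (1 + (1 + (1 + (11 * N.size + 1)))))))
    (Tri.arith_seq ?_ ?_ <| Tri.arith_seq ?_ ?_ <| Tri.arith_seq ?_ ?_ <| Tri.arith_seq ?_ ?_ <|
      Tri.arith_seq ?_ ?_ <| Tri.arith_seq ?_ ?_ <| Tri.loop (EuclidInv m o x y)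
        ?bound ?exit ?step ?init) (by lia) (fun _ _ => id)
  case bound =>
    rintro b m' o' h
    exact ⟨(h.lt.le.trans h.le).trans hyN', le_of_add_le_right h.time⟩
  case exit =>
    rintro b m' o' h h0
    have hg := h.gcd
    rw [h0, Nat.gcd_zero_right] at hg
    exact ⟨h.out, hg, h.lt₀, hg ▸ h.modEq₀, h.frame⟩
  case step =>
    rintro b m' o' h h0
    have h1 := size_mul_mod_lt h0 h.lt
    have h2 := h.time
    -- A pass costs ten instructions and the test of the loop, and removes at least one bit.
    exact ⟨10, b - 11, by lia, euclidStep_spec hyN h8 h h0⟩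
  case init =>
    constructor
    case time =>
      simp [ArithOp.eval, h8, h9, hX, hY]
      apply Nat.size_le_size
      nlinarith
    case gcd =>
      simp [ArithOp.eval, h8, h9, hX, hY]
      rw [Nat.gcd_comm, ← Nat.gcd_rec, Nat.gcd_comm]
    case modEq₁ =>
      simp [ArithOp.eval, h8, h9, hX, hY]
      exact ((Nat.mod_modEq 1 y).mul_right x).trans (by simp [Nat.ModEq])
    case frame =>
      intro i hi
      simp [show i ≠ 1 by lia, show i ≠ 2 by lia, show i ≠ 3 by lia, show i ≠ 4 by lia,
        show i ≠ 5 by lia, show i ≠ 6 by lia]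
    all_goals simp [ArithOp.eval, h8, h9, hX, hY, hy, hmod, hmod', Nat.ModEq]
  all_goals try simp [ArithOp.eval, h8, h9, hX, hY]
  all_goals lia

end RAMProg

/-! ### Sieve values and Korselt's criterion. -/

/-- The least common multiple of the `p - 1` for the prime divisors `p < q` of `a`, or `0` if `a`
is divisible by the square of a prime below `q`. -/
noncomputable def sieveVal (q a : ℕ) : ℕ :=
  open Classical in
  if ∃ p < q, p.Prime ∧ p ∣ a / p ∧ p ∣ a then 0
  else (a.primeFactors.filter (· < q)).lcm (· - 1)

/-- The least common multiple of the `p - 1` for the prime divisors `p` of `a`, or `0` if `a`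
is not squarefree. -/
noncomputable def predLcm (a : ℕ) : ℕ := sieveVal (a + 1) a

theorem Nat.dvd_div_self_iff {p a : ℕ} (hp : 0 < p) (h : p ∣ a) : p ∣ a / p ↔ p * p ∣ a := by
  obtain ⟨b, rfl⟩ := h
  rw [Nat.mul_div_cancel_left _ hp, Nat.mul_dvd_mul_iff_left hp]

/-- Since 0 divides no `x ≠ 0`, the default value 0 lets a single divisibility test check
squarefreeness as well. -/
theorem sieveVal_dvd_iff {q a x : ℕ} (ha : a ≠ 0) (hx : x ≠ 0) :
    sieveVal q a ∣ x ↔ ∀ p < q, p.Prime → p ∣ a → ¬ p * p ∣ a ∧ p - 1 ∣ x := by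
  unfold sieveVal
  split_ifs with h
  · obtain ⟨p, h1, h2, h3, h4⟩ := h
    simp only [zero_dvd_iff, hx, false_iff]
    exact fun h => (h p h1 h2 h4).1 ((Nat.dvd_div_self_iff h2.pos h4).1 h3)
  · push Not at h
    rw [Finset.lcm_dvd_iff]
    simp only [Finset.mem_filter, Nat.mem_primeFactors]
    refine ⟨fun H p h1 h2 h3 => ⟨fun h4 => ?_, H p ⟨⟨h2, h3, ha⟩, h1⟩⟩, fun H p hp =>
      (H p hp.2 hp.1.1 hp.1.2.1).2⟩
    exact h p h1 h2 ((Nat.dvd_div_self_iff h2.pos h3).2 h4) h3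

theorem sieveVal_ne_zero {q a : ℕ} (h : ∀ p < q, p.Prime → p ∣ a → ¬ p * p ∣ a) :
    sieveVal q a ≠ 0 := by
  unfold sieveVal
  rw [if_neg]
  · rw [Ne, Finset.lcm_eq_zero_iff]
    simp only [Finset.mem_filter, Nat.mem_primeFactors]
    rintro ⟨p, hp, h0⟩
    have := hp.1.1.two_le
    lia
  · rintro ⟨p, h1, h2, h3, h4⟩
    exact h p h1 h2 h4 ((Nat.dvd_div_self_iff h2.pos h4).1 h3)

/-- There are no primes below 2, so the sieve starts from a table of ones. -/
theorem sieveVal_two {a : ℕ} : sieveVal 2 a = 1 := by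
  have h2 : ∀ p < 2, ¬ p.Prime := fun p h hp => by have := hp.two_le; lia
  unfold sieveVal
  rw [if_neg, Finset.filter_false_of_mem, Finset.lcm_empty]
  · exact fun p hp h => h2 p h (Nat.prime_of_mem_primeFactors hp)
  · rintro ⟨p, h, hp, -⟩
    exact h2 p h hp

theorem sieveVal_succ_of_not {p a : ℕ} (h : ¬ (p.Prime ∧ p ∣ a)) :
    sieveVal (p + 1) a = sieveVal p a := by
  unfold sieveVal
  have h1 : (a.primeFactors.filter (· < p + 1)) = a.primeFactors.filter (· < p) := by
    ext q
    simp only [Finset.mem_filter, Nat.mem_primeFactors]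
    constructor
    · rintro ⟨h1, h2⟩
      refine ⟨h1, lt_of_le_of_ne (by lia) ?_⟩
      rintro rfl
      exact h ⟨h1.1, h1.2.1⟩
    · rintro ⟨h1, h2⟩
      exact ⟨h1, by lia⟩
  have h2 : (∃ q < p + 1, q.Prime ∧ q ∣ a / q ∧ q ∣ a) ↔ ∃ q < p, q.Prime ∧ q ∣ a / q ∧ q ∣ a := by
    constructor
    · rintro ⟨q, h1, h2⟩
      refine ⟨q, lt_of_le_of_ne (by lia) ?_, h2⟩
      rintro rfl
      exact h ⟨h2.1, h2.2.2⟩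
    · rintro ⟨q, h1, h2⟩
      exact ⟨q, by lia, h2⟩
  rw [h1]
  simp only [h2]

/-- The update made by the sieve at a multiple of `p`. An entry that is already 0 stays 0, because
an lcm with 0 is 0. -/
theorem sieveVal_succ {p a : ℕ} (hp : p.Prime) (ha : a ≠ 0) (h : p ∣ a) :
    sieveVal (p + 1) a = if p ∣ a / p then 0 else (sieveVal p a).lcm (p - 1) := by
  have h1 : (a.primeFactors.filter (· < p + 1)) = insert p (a.primeFactors.filter (· < p)) := by
    ext q
    simp only [Finset.mem_filter, Nat.mem_primeFactors, Finset.mem_insert, Nat.lt_succ_iff_lt_or_eq]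
    constructor
    · rintro ⟨h1, h2 | h2⟩
      · exact .inr ⟨h1, h2⟩
      · exact .inl h2
    · rintro (rfl | h1)
      · exact ⟨⟨hp, h, ha⟩, .inr rfl⟩
      · exact ⟨h1.1, .inl h1.2⟩
  unfold sieveVal
  split_ifs with h2 h3 h4 h5 h6
  · rfl
  · simp
  · obtain ⟨q, hq, hq'⟩ := h2
    rcases Nat.lt_succ_iff_lt_or_eq.1 hq with h | rfl
    · exact absurd ⟨q, h, hq'⟩ h4
    · exact absurd hq'.2.1 h3
  · exact absurd ⟨p, by lia, hp, h5, h⟩ h2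
  · obtain ⟨q, hq, hq'⟩ := h6
    exact absurd ⟨q, by lia, hq'⟩ h2
  · rw [h1, Finset.lcm_insert, lcm_comm]
    rfl

theorem sieveVal_of_lt {q a : ℕ} (h : a < q) (ha : a ≠ 0) : sieveVal q a = predLcm a := by
  induction q, (Nat.succ_le_of_lt h) using Nat.le_induction with
  | base => rfl
  | succ q hq ih =>
    rw [sieveVal_succ_of_not, ih (by lia)]
    exact fun h' => by have := Nat.le_of_dvd (by lia) h'.2; lia

/-- The sieve recognizes its primes by this. A prime has no smaller prime factor. For a composite
number the value 1 forces every prime factor to be 2, hence divisibility by 4, but then the value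
would be 0. -/
theorem sieveVal_self_eq_one_iff {p : ℕ} (hp : 2 ≤ p) : sieveVal p p = 1 ↔ p.Prime := by
  constructor
  · intro h
    by_contra hp'
    have H := (sieveVal_dvd_iff (q := p) (a := p) (x := 1) (by lia) one_ne_zero).1 (by simp [h])
    have h2 : ∀ q, q.Prime → q ∣ p → q = 2 := fun q hq hqp => by
      have hlt : q < p := lt_of_le_of_ne (Nat.le_of_dvd (by lia) hqp) (by rintro rfl; exact hp' hq)
      have := Nat.le_of_dvd one_pos (H q hlt hq hqp).2
      have := hq.two_le
      lia
    obtain ⟨q, hq, hqp⟩ := Nat.exists_prime_and_dvd (show p ≠ 1 by lia)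
    obtain rfl := h2 q hq hqp
    obtain ⟨b, rfl⟩ := hqp
    have hb : b ≠ 1 := by rintro rfl; exact hp' hq
    obtain ⟨r, hr, hrb⟩ := Nat.exists_prime_and_dvd hb
    obtain rfl := h2 r hr (hrb.mul_left _)
    have hb0 := Nat.le_of_dvd (by lia) hrb
    exact (H 2 (by lia) hq ⟨b, rfl⟩).1 (Nat.mul_dvd_mul_left 2 hrb)
  · intro h
    refine Nat.dvd_one.1 ((sieveVal_dvd_iff (by lia) one_ne_zero).2 fun q hq hq' hqp => ?_)
    exact absurd ((Nat.prime_dvd_prime_iff_eq hq' h).1 hqp) hq.ne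

/-- The lcm divides the product of the `p - 1`, which is at most the radical of `a`. -/
theorem sieveVal_le (q : ℕ) {a : ℕ} (ha : a ≠ 0) : sieveVal q a ≤ a := by
  by_cases h : ∃ p < q, p.Prime ∧ p ∣ a / p ∧ p ∣ a
  · simp [sieveVal, h]
  · rw [sieveVal, if_neg h]
    have h1 : ∀ p ∈ a.primeFactors.filter (· < q), 0 < p - 1 := fun p hp => by
      have := (Nat.prime_of_mem_primeFactors (Finset.mem_filter.1 hp).1).two_le
      lia
    calc _ ≤ ∏ p ∈ a.primeFactors.filter (· < q), (p - 1) :=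
          Nat.le_of_dvd (Finset.prod_pos h1) (Finset.lcm_dvd fun p hp => Finset.dvd_prod_of_mem _ hp)
      _ ≤ ∏ p ∈ a.primeFactors.filter (· < q), p := Finset.prod_le_prod' fun p _ => Nat.sub_le _ _
      _ ≤ ∏ p ∈ a.primeFactors, p := Finset.prod_le_prod_of_subset_of_one_le'
          (Finset.filter_subset _ _) fun p hp _ => (Nat.prime_of_mem_primeFactors hp).one_le
      _ ≤ a := Nat.le_of_dvd (Nat.pos_of_ne_zero ha) (Nat.prod_primeFactors_dvd a)

theorem predLcm_le {a : ℕ} (ha : a ≠ 0) : predLcm a ≤ a := sieveVal_le _ ha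

theorem predLcm_dvd_iff {a x : ℕ} (ha : a ≠ 0) (hx : x ≠ 0) :
    predLcm a ∣ x ↔ Squarefree a ∧ ∀ p, p.Prime → p ∣ a → p - 1 ∣ x := by
  rw [predLcm, sieveVal_dvd_iff ha hx, Nat.squarefree_iff_prime_squarefree]
  refine ⟨fun H => ⟨fun p hp h => ?_, fun p hp h => ?_⟩, fun H p _ hp h => ⟨H.1 p hp, H.2 p hp h⟩⟩
  · have h' : p ∣ a := (Dvd.intro _ rfl).trans h
    exact (H p (Nat.lt_succ_of_le (Nat.le_of_dvd (by lia) h')) hp h').1 h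
  · exact (H p (Nat.lt_succ_of_le (Nat.le_of_dvd (by lia) h)) hp h).2

theorem predLcm_ne_zero {a : ℕ} (h : Squarefree a) : predLcm a ≠ 0 :=
  sieveVal_ne_zero fun p _ hp _ hpp => Nat.squarefree_iff_prime_squarefree.1 h p hp hpp

theorem predLcm_prime {p : ℕ} (hp : p.Prime) : predLcm p = p - 1 := by
  have h1 := hp.two_le
  apply Nat.dvd_antisymm
  · refine (predLcm_dvd_iff (by lia) (by lia)).2 ⟨hp.squarefree, fun q hq h => ?_⟩
    rw [(Nat.prime_dvd_prime_iff_eq hq hp).1 h]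
  · exact ((predLcm_dvd_iff (by lia) (predLcm_ne_zero hp.squarefree)).1 dvd_rfl).2 p hp dvd_rfl

/-- Korselt's criterion. Taking `a = p` excludes `p ^ 2 ∣ n`; the cyclic group of units modulo `p`,
of order `p - 1`, forces `p - 1 ∣ n - 1`. Conversely the congruence holds modulo each prime factor,
by Fermat, and these are pairwise coprime. -/
theorem isCarmichael_iff {n : ℕ} (hn : 1 < n) :
    IsCarmichael n ↔ ¬ n.Prime ∧ predLcm n ∣ n - 1 := by
  have hn0 : n ≠ 0 := by lia
  have : NeZero n := ⟨hn0⟩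
  rw [predLcm_dvd_iff hn0 (by lia)]
  refine ⟨fun ⟨_, h2, h3⟩ => ⟨h2, ?_, fun p hp hpn => ?_⟩, fun ⟨h2, h3, h4⟩ => ⟨hn, h2, fun a => ?_⟩⟩
  · rw [Nat.squarefree_iff_prime_squarefree]
    intro p hp hpp
    have h4 : ((p ^ n : ℕ) : ZMod n) = (p : ℕ) := by exact_mod_cast h3 p
    rw [ZMod.natCast_eq_natCast_iff] at h4
    have h5 : p * p ∣ p ^ n := by rw [← sq]; exact pow_dvd_pow p hn
    have h6 : p * p ∣ p := ((h4.of_dvd hpp).dvd_iff dvd_rfl).1 h5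
    have := Nat.le_of_dvd hp.pos h6
    have := hp.two_le
    nlinarith
  · have : Fact p.Prime := ⟨hp⟩
    have h4 := (FiniteField.forall_pow_eq_one_iff (ZMod p) (n - 1)).1 fun u => by
      obtain ⟨a, ha⟩ := ZMod.castHom_surjective hpn (u : ZMod p)
      have h5 := congrArg (ZMod.castHom hpn (ZMod p)) (h3 a)
      rw [map_pow, ha] at h5
      have h6 : u ^ n = u := Units.ext (by simpa using h5)
      obtain ⟨k, rfl⟩ : ∃ k, n = k + 1 := ⟨n - 1, by lia⟩
      rw [pow_succ, mul_eq_right] at h6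
      exact h6
    simpa using h4
  · obtain ⟨a, rfl⟩ := ZMod.natCast_zmod_surjective a
    suffices h : (n : ℤ) ∣ (a : ℤ) ^ n - a by
      have := (ZMod.intCast_zmod_eq_zero_iff_dvd ((a : ℤ) ^ n - a) n).2 h
      push_cast at this
      exact sub_eq_zero.1 this
    rw [← Nat.prod_primeFactors_of_squarefree h3, Nat.cast_prod]
    refine Finset.prod_dvd_of_coprime (fun p hp q hq hpq => ?_) fun p hp => ?_
    · exact Nat.isCoprime_iff_coprime.2 ((Nat.coprime_primes
        (Nat.prime_of_mem_primeFactors hp) (Nat.prime_of_mem_primeFactors hq)).2 hpq)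
    · rw [Nat.prod_primeFactors_of_squarefree h3]
      have hp' := Nat.prime_of_mem_primeFactors hp
      have : Fact p.Prime := ⟨hp'⟩
      obtain ⟨k, hk⟩ := h4 p hp' (Nat.dvd_of_mem_primeFactors hp)
      rw [← ZMod.intCast_zmod_eq_zero_iff_dvd]
      push_cast
      rcases eq_or_ne (a : ZMod p) 0 with h0 | h0
      · simp [h0, hn0]
      · obtain ⟨l, rfl⟩ : ∃ l, n = l + 1 := ⟨n - 1, by lia⟩
        rw [Nat.add_sub_cancel] at hk
        rw [pow_succ, hk, pow_mul, ZMod.pow_card_sub_one_eq_one h0]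
        simp

/-- Here `predLcm n` divides `φ(n)`, so equality with `n - 1` forces `φ(n) = n - 1`, i.e. `n` prime.
Compositeness can thus be read off the table. -/
theorem predLcm_lt_sub_one_iff {n : ℕ} (hn : 1 < n) (h : predLcm n ∣ n - 1) :
    predLcm n < n - 1 ↔ ¬ n.Prime := by
  refine ⟨fun h1 h2 => by rw [predLcm_prime h2] at h1; lia, fun h1 => ?_⟩
  refine lt_of_le_of_ne (Nat.le_of_dvd (by lia) h) fun h2 => h1 ?_
  obtain ⟨h3, h4⟩ := (predLcm_dvd_iff (by lia) (by lia)).1 h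
  have h5 : predLcm n ∣ n.totient := by
    refine (predLcm_dvd_iff (by lia) (Nat.totient_pos.2 (by lia)).ne').2 ⟨h3, fun p hp hpn => ?_⟩
    rw [← Nat.totient_prime hp]
    exact Nat.totient_dvd_of_dvd hpn
  have h6 := Nat.le_of_dvd (Nat.totient_pos.2 (by lia)) h5
  have h7 := Nat.totient_lt n hn
  exact (Nat.totient_eq_iff_prime (by lia)).1 (by lia)

theorem isCarmichael_iff_lt {n : ℕ} (hn : 1 < n) :
    IsCarmichael n ↔ predLcm n ∣ n - 1 ∧ predLcm n < n - 1 := by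
  rw [isCarmichael_iff hn, and_comm]
  exact and_congr_right fun h => (predLcm_lt_sub_one_iff hn h).symm

/-- This tests `d * b` from the table entries of its two factors. -/
theorem isCarmichael_mul_iff {d b : ℕ} (hd : 2 ≤ d) (hb : 2 ≤ b) :
    IsCarmichael (d * b) ↔
      predLcm d ∣ d * b - 1 ∧ predLcm b ∣ d * b - 1 ∧ Nat.gcd d b = 1 := by
  have h1 : 4 ≤ d * b := Nat.mul_le_mul hd hb
  have hx : d * b - 1 ≠ 0 := by lia
  have hnp : ¬ (d * b).Prime := Nat.not_prime_mul (by lia) (by lia)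
  rw [isCarmichael_iff (by lia), predLcm_dvd_iff (by lia) hx, predLcm_dvd_iff (by lia) hx,
    predLcm_dvd_iff (by lia) hx, Nat.squarefree_mul_iff]
  simp only [hnp, not_false_iff, true_and]
  constructor
  · rintro ⟨⟨h2, h3, h4⟩, h5⟩
    exact ⟨⟨h3, fun p hp h => h5 p hp (h.mul_right _)⟩, ⟨h4, fun p hp h => h5 p hp (h.mul_left _)⟩, h2⟩
  · rintro ⟨⟨h3, h5⟩, ⟨h4, h6⟩, h2⟩
    exact ⟨⟨h2, h3, h4⟩, fun p hp h => (hp.dvd_mul.1 h).elim (h5 p hp) (h6 p hp)⟩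

/-! ### Divisors that leave few candidates. -/

section Divisors

variable {B T D d b n : ℕ}

theorem sq_threshold_le (hT : 0 < T) (hTB : T ^ 3 ≤ B) : T ^ 2 ≤ B / T := by
  rw [Nat.le_div_iff_mul_le hT]
  exact hTB

/-- This ensures that the table contains the entry of the cofactor. If `D < d * T`, then `b < T ^ 2
≤ B / T`; otherwise `T ≤ d` and so `T * b < B < T * D`. -/
theorem cofactor_le (hT : 0 < T) (hTB : T ^ 3 ≤ B) (hD : D = B / T + 1) (hd : d ≠ 0)
    (h : D < d * T ∨ T ≤ predLcm d) (hdb : d * b < B) : b ≤ D := by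
  have h1 := sq_threshold_le hT hTB
  have h2 : B < T * D := by rw [hD]; exact Nat.lt_mul_div_succ B hT
  rcases h with h | h
  · suffices b < T ^ 2 by lia
    refine lt_of_mul_lt_mul_right (a := D) ?_ (Nat.zero_le _)
    calc b * D ≤ b * (d * T) := Nat.mul_le_mul_left _ h.le
      _ = (d * b) * T := by ring
      _ ≤ B * T := Nat.mul_le_mul_right _ hdb.le
      _ < T * D * T := Nat.mul_lt_mul_of_pos_right h2 hT
      _ = _ := by ring
  · have h3 : T ≤ d := h.trans (predLcm_le hd)
    have h4 : T * b < T * D := (Nat.mul_le_mul_right _ h3).trans_lt (hdb.trans h2)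
    exact (lt_of_mul_lt_mul_left h4 (Nat.zero_le _)).le

/-- A Carmichael number below `B` is small or has a divisor that leaves few candidates. -/
theorem IsCarmichael.exists_divisor (hn : IsCarmichael n) (hnB : n < B) (hT : 0 < T)
    (hTB : T ^ 3 ≤ B) (hD : D = B / T + 1) (hnD : D < n) :
    ∃ d b, n = d * b ∧ 2 ≤ d ∧ d ≤ D ∧ 2 ≤ b ∧ (D < d * T ∨ T ≤ predLcm d) := by
  have h1 := sq_threshold_le hT hTB
  have h2 : B < T * D := by rw [hD]; exact Nat.lt_mul_div_succ B hT
  have hTT : T ≤ T ^ 2 := Nat.le_self_pow two_ne_zero T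
  have hn1 : 1 < n := hn.1
  obtain ⟨hnp, hdvd⟩ := (isCarmichael_iff hn1).1 hn
  obtain ⟨-, hdvd⟩ := (predLcm_dvd_iff (by lia) (by lia)).1 hdvd
  -- A prime `p > T` can serve as `d`: from `p - 1 ∣ n / p - 1` follows `p ≤ n / p`, so `p > D`
  -- would give `n ≥ T * D > B`.
  by_cases H : ∃ p, p.Prime ∧ p ∣ n ∧ T < p
  · obtain ⟨p, hp, ⟨b, rfl⟩, hTp⟩ := H
    have hp2 := hp.two_le
    have hb0 : b ≠ 0 := by rintro rfl; lia
    have hb1 : b ≠ 1 := by rintro rfl; exact hnp (by simpa using hp)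
    have h3 : p - 1 ∣ b - 1 := by
      have h4 := hdvd p hp ⟨b, rfl⟩
      have h5 : p * b - 1 = (p - 1) * b + (b - 1) := by
        obtain ⟨q, rfl⟩ : ∃ q, p = q + 1 := ⟨p - 1, by lia⟩
        rw [Nat.add_sub_cancel, add_mul]
        lia
      rw [h5] at h4
      exact (Nat.dvd_add_right (Dvd.intro _ rfl)).1 h4
    have h4 := Nat.le_of_dvd (by lia) h3
    refine ⟨p, b, rfl, hp2, ?_, by lia, .inr ?_⟩
    · by_contra! h5
      have h6 : T * D ≤ p * b := Nat.mul_le_mul hTp.le (by lia)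
      lia
    · rw [predLcm_prime hp]
      lia
  · push Not at H
    -- All prime factors are now at most `T`. The largest divisor `d ≤ D` exceeds `D` once
    -- multiplied by a further prime factor, whence `D < d * T`.
    have hne : (n.divisors.filter (· ≤ D)).Nonempty :=
      ⟨1, by simp only [Finset.mem_filter, Nat.mem_divisors]; exact ⟨⟨one_dvd _, by lia⟩, by lia⟩⟩
    obtain ⟨d, hd, hmax⟩ := Finset.exists_max_image _ id hne
    simp only [Finset.mem_filter, Nat.mem_divisors, id] at hd hmax
    obtain ⟨⟨⟨b, rfl⟩, hn0⟩, hdD⟩ := hd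
    have hb1 : b ≠ 1 := by rintro rfl; lia
    have hb0 : b ≠ 0 := by rintro rfl; lia
    obtain ⟨p, hp, c, rfl⟩ := Nat.exists_prime_and_dvd hb1
    have hpT := H p hp ⟨d * c, by ring⟩
    have hd0 : 0 < d := Nat.pos_of_ne_zero (by rintro rfl; lia)
    have h3 : D < d * p := by
      by_contra! h4
      have h5 := hmax (d * p) ⟨⟨⟨c, by ring⟩, hn0⟩, h4⟩
      have := hp.two_le
      nlinarith
    have h4 : D < d * T := h3.trans_le (Nat.mul_le_mul_left _ hpT)
    refine ⟨d, p * c, rfl, ?_, hdD, by lia, .inl h4⟩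
    by_contra! h5
    obtain rfl : d = 1 := by lia
    lia

end Divisors

/-! ### Sieving the table on the machine. -/

/-- The length of the table of the values of `predLcm`. -/
def tableSize (B : ℕ) : ℕ := B / threshold B + 1

theorem tableSize_le (B : ℕ) : tableSize B ≤ B + 1 := Nat.succ_le_succ (Nat.div_le_self _ _)

/-- A bound for the operands on input `B`. -/
def opBound (B : ℕ) : ℕ := (B + 40) ^ 2

theorem opBound_eq (B : ℕ) : opBound B = B * B + 80 * B + 1600 := by
  unfold opBound
  ring

namespace RAMProg

theorem Tri.seq_of {N : ℕ} {c d : RAMProg} {m : ℕ → ℕ} {o : List ℕ} {k₁ k₂ : ℕ}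
    {P R : (ℕ → ℕ) → List ℕ → Prop} (h : Tri N c m o k₁ P)
    (h' : ∀ m' o', P m' o' → Tri N d m' o' k₂ R) : Tri N (.seq c d) m o (k₁ + k₂) R :=
  .seq (h.mono le_rfl h')

/-- The contents of the cells that keep their value after the initialization. -/
structure Globals (B : ℕ) (m : ℕ → ℕ) : Prop where
  zero : m 8 = 0
  one : m 9 = 1
  input : m 10 = B
  thr : m 11 = threshold B
  len : m 12 = tableSize B
  base : m 30 = 32

theorem Globals.congr {B : ℕ} {m m' : ℕ → ℕ} (h : Globals B m)
    (hf : ∀ i, 7 < i → i < 13 ∨ i = 30 → m' i = m i) : Globals B m' :=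
  ⟨(hf 8 (by lia) (by lia)).trans h.zero, (hf 9 (by lia) (by lia)).trans h.one,
    (hf 10 (by lia) (by lia)).trans h.input, (hf 11 (by lia) (by lia)).trans h.thr,
    (hf 12 (by lia) (by lia)).trans h.len, (hf 30 (by lia) (by lia)).trans h.base⟩

/-- Treat the multiple `M[15]` of the prime `M[13]`. -/
def sieveStep : RAMProg :=
  .seq (.arith .add 19 15 30) <| .seq (.load 1 19) <| .seq (.arith .add 17 1 8) <|
  .seq (.arith .add 2 20 8) <| .seq euclid <| .seq (.arith .mul 17 17 20) <|
  .seq (.arith .div 17 17 1) <| .seq (.arith .div 18 15 13) <| .seq (.arith .mod 18 18 13) <|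
  .seq (.ite 18 .skip (.const 17 0)) <| .seq (.store 19 17) <| .seq (.arith .add 15 15 13) <|
  .arith .sub 16 16 9

/-- The lcm is computed as `v * (p - 1) / gcd`. The frame condition allows writing to the working
cells and to the one table entry of `a`. -/
theorem sieveStep_spec {B p a c v : ℕ} {m : ℕ → ℕ} {o : List ℕ} (hg : Globals B m)
    (hp : 2 ≤ p) (hpB : p ≤ B + 1) (haB : a ≤ B + 1) (h13 : m 13 = p) (h15 : m 15 = a)
    (h16 : m 16 = c) (hc : c ≤ B + 1) (h20 : m 20 = p - 1) (hv : m (a + 32) = v) (hva : v ≤ a) :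
    Tri (opBound B) sieveStep m o (11 * (opBound B).size + 21) fun m' o' => o' = o ∧
      m' 15 = a + p ∧ m' 16 = c - 1 ∧ m' (a + 32) = (if p ∣ a / p then 0 else v.lcm (p - 1)) ∧
      ∀ i, 7 < i → i < 15 ∨ 19 < i → i ≠ a + 32 → m' i = m i := by
  have hN := opBound_eq B
  obtain ⟨g8, g9, g10, g11, g12, g30⟩ := hg
  refine Tri.mono (k₁ := 1 + (1 + (1 + (1 + ((11 * (opBound B).size + 7) +
    (1 + (1 + (1 + (1 + ((1 + 1 + 1) + (1 + (1 + 1)))))))))))) (Tri.arith_seq ?_ ?_ <|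
      Tri.load_seq ?_ ?_ <| Tri.arith_seq ?_ ?_ <| Tri.arith_seq ?_ ?_ <| Tri.seq_of
      (euclid_spec ?_ ?_ ?_ ?_ ?_) ?rest) (by lia) (fun _ _ => id)
  case rest =>
    simp [ArithOp.eval, g8, g30, h15, hv, h20]
    rintro m' e1 - - ef
    have f : ∀ i, 7 < i → i ≠ 17 → i ≠ 19 → m' i = m i := fun i h1 h2 h3 => by
      rw [ef i h1]
      simp [h2, h3, show i ≠ 1 by lia, show i ≠ 2 by lia]
    have f17 : m' 17 = v := by rw [ef 17 (by lia)]; simp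
    have f19 : m' 19 = a + 32 := by rw [ef 19 (by lia)]; simp
    have f9 : m' 9 = 1 := (f 9 (by lia) (by lia) (by lia)).trans g9
    have f13 : m' 13 = p := (f 13 (by lia) (by lia) (by lia)).trans h13
    have f15 : m' 15 = a := (f 15 (by lia) (by lia) (by lia)).trans h15
    have f16 : m' 16 = c := (f 16 (by lia) (by lia) (by lia)).trans h16
    have f20 : m' 20 = p - 1 := (f 20 (by lia) (by lia) (by lia)).trans h20
    have hvp : v * (p - 1) ≤ opBound B :=
      (Nat.mul_le_mul (hva.trans haB) ((Nat.sub_le _ _).trans hpB)).trans (by lia)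
    have hgcd : v.gcd (p - 1) ≤ p - 1 := Nat.gcd_le_right _ (by lia)
    have hl : v.lcm (p - 1) ≤ opBound B := (Nat.div_le_self _ _).trans hvp
    have hap : a / p ≤ a := Nat.div_le_self _ _
    have hapm : a / p % p < p := Nat.mod_lt _ (by lia)
    refine Tri.mono (k₁ := 1 + (1 + (1 + (1 + ((1 + 1 + 1) + (1 + (1 + 1)))))))
      (Tri.arith_seq ?_ ?_ <| Tri.arith_seq ?_ ?_ <| Tri.arith_seq ?_ ?_ <|
      Tri.arith_seq ?_ ?_ <| Tri.seq_of (Tri.ite_add ?_ ?_ ?_ (P := fun m₂ o₂ => o₂ = o ∧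
        m₂ 17 = (if p ∣ a / p then 0 else v.lcm (p - 1)) ∧
        ∀ i, i ≠ 17 → i ≠ 18 → m₂ i = m' i)) ?last) le_rfl (fun _ _ => id)
    case last =>
      rintro m₂ o₂ ⟨rfl, k17, kf⟩
      have k9 : m₂ 9 = 1 := (kf 9 (by lia) (by lia)).trans f9
      have k13 : m₂ 13 = p := (kf 13 (by lia) (by lia)).trans f13
      have k15 : m₂ 15 = a := (kf 15 (by lia) (by lia)).trans f15
      have k16 : m₂ 16 = c := (kf 16 (by lia) (by lia)).trans f16
      have k19 : m₂ 19 = a + 32 := (kf 19 (by lia) (by lia)).trans f19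
      refine Tri.store_seq ?_ ?_ <| Tri.arith_seq ?_ ?_ <| Tri.arith ?_ ?_
        ⟨rfl, ?_, ?_, ?_, fun i h1 h2 h3 => ?frame⟩
      case frame =>
        rw [← f i h1 (by lia) (by lia), ← kf i (by lia) (by lia), k19]
        simp [h3, show i ≠ 15 by lia, show i ≠ 16 by lia]
      all_goals simp [ArithOp.eval, k9, k13, k15, k16, k17, k19]
      all_goals lia
    all_goals simp [ArithOp.eval, e1, f13, f15, f17, f20]
    · lia
    · lia
    · lia
    · lia
    · lia
    · lia
    · lia
    · lia
    · lia
    · intro h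
      refine Tri.skip ⟨rfl, ?_, fun i h1 h2 => by simp [h1, h2]⟩
      simp [Nat.dvd_iff_mod_eq_zero, h, Nat.lcm]
    · intro h
      refine Tri.const (by lia) ⟨rfl, ?_, fun i h1 h2 => by simp [h1, h2]⟩
      simp [Nat.dvd_iff_mod_eq_zero, h]
  all_goals try simp [ArithOp.eval, g8, g9, g30, h15, hv, h20]
  all_goals try lia
  · have : p - 1 + 1 = p := by lia
    rw [this]
    nlinarith

end RAMProg

namespace RAMProg

/-- The memory contains a table of the values of `f` from address `33` on. -/
def Table (B : ℕ) (f : ℕ → ℕ) (m : ℕ → ℕ) : Prop :=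
  ∀ a, a ≠ 0 → a ≤ tableSize B → m (a + 32) = f a

theorem Table.congr {B : ℕ} {f : ℕ → ℕ} {m m' : ℕ → ℕ} (h : Table B f m)
    (hf : ∀ i, 32 < i → m' i = m i) : Table B f m' :=
  fun a h1 h2 => (hf _ (by lia)).trans (h a h1 h2)

theorem sieveMultiples_spec {B p : ℕ} {m : ℕ → ℕ} {o : List ℕ} (hg : Globals B m) (hp : p.Prime)
    (hpD : p ≤ tableSize B) (h13 : m 13 = p) (h15 : m 15 = p) (h16 : m 16 = tableSize B / p)
    (h20 : m 20 = p - 1) (ht : Table B (sieveVal p) m) :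
    Tri (opBound B) (.loop 16 sieveStep) m o
      ((11 * (opBound B).size + 22) * (tableSize B / p) + 1) fun m' o' => o' = o ∧
      Table B (sieveVal (p + 1)) m' ∧ ∀ i, 7 < i → i < 15 ∨ (19 < i ∧ i < 33) → m' i = m i := by
  have hN := opBound_eq B
  have hD := tableSize_le B
  have hp2 := hp.two_le
  generalize hq : tableSize B / p = q at *
  have hqD : p * q ≤ tableSize B := hq ▸ Nat.mul_div_le _ _
  have hDq : tableSize B < p * (q + 1) := hq ▸ Nat.lt_mul_div_succ _ hp.pos
  have hqB : q ≤ B + 1 := by nlinarith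
  -- The entries below `p * j` are up to date. Those strictly between two multiples of `p` need no
  -- update.
  refine Tri.loop (fun b m' o' => ∃ j, 1 ≤ j ∧ j ≤ q + 1 ∧ m' 15 = p * j ∧ m' 16 = q + 1 - j ∧
    (11 * (opBound B).size + 22) * (q + 1 - j) + 1 ≤ b ∧ o' = o ∧
    Table B (fun a => if a < p * j then sieveVal (p + 1) a else sieveVal p a) m' ∧
    ∀ i, 7 < i → i < 15 ∨ (19 < i ∧ i < 33) → m' i = m i) ?_ ?_ ?_ ?_
  · rintro b m' o' ⟨j, h1, h2, h3, h4, h5, -⟩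
    exact ⟨by lia, by lia⟩
  · rintro b m' o' ⟨j, h1, h2, h3, h4, h5, h6, h7, h8⟩ h0
    obtain rfl : j = q + 1 := by lia
    refine ⟨h6, fun a ha0 haD => ?_, h8⟩
    exact (h7 a ha0 haD).trans (if_pos (by lia))
  · rintro b m' o' ⟨j, h1, h2, h3, h4, h5, h6, h7, h8⟩ h0
    have hjq : j ≤ q := by lia
    have hpj : p * j ≤ tableSize B := (Nat.mul_le_mul_left _ hjq).trans hqD
    have hpj0 : p * j ≠ 0 := mul_ne_zero hp.ne_zero (by lia)
    have hv : m' (p * j + 32) = sieveVal p (p * j) := by simpa using h7 _ hpj0 hpj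
    refine ⟨11 * (opBound B).size + 21, (11 * (opBound B).size + 22) * (q - j) + 1, ?_,
      (sieveStep_spec (hg.congr fun i h h' => h8 i h (by lia)) hp2 (by lia) (by lia)
        ((h8 13 (by lia) (by lia)).trans h13) h3 h4 (by lia)
        ((h8 20 (by lia) (by lia)).trans h20) hv (sieveVal_le _ hpj0)).mono le_rfl ?_⟩
    · have : q + 1 - j = (q - j) + 1 := by lia
      rw [this] at h5
      lia
    · rintro m₂ o₂ ⟨e1, e2, e3, e4, e5⟩
      have hjs : p * (j + 1) = p * j + p := by ring
      refine ⟨j + 1, by lia, by lia, by rw [e2]; ring, by lia, by lia, e1.trans h6, ?_,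
        fun i h h' => (e5 i h (by lia) (by lia)).trans (h8 i h h')⟩
      intro a ha0 haD
      dsimp only
      by_cases haj : a = p * j
      · subst haj
        rw [e4, if_pos (show p * j < p * (j + 1) by lia), sieveVal_succ hp ha0 (Dvd.intro _ rfl)]
      · rw [e5 _ (by lia) (by lia) (by lia), h7 a ha0 haD]
        dsimp only
        by_cases hlt : a < p * j
        · rw [if_pos hlt, if_pos (by lia)]
        · rw [if_neg hlt]
          split_ifs with hlt'
          · rw [sieveVal_succ_of_not]
            rintro ⟨-, k, rfl⟩
            have k1 : j < k := by
              by_contra! hk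
              have := Nat.mul_le_mul_left p hk
              lia
            have k2 : k < j + 1 := lt_of_mul_lt_mul_left hlt' (Nat.zero_le _)
            lia
          · rfl
  · refine ⟨1, le_rfl, by lia, by lia, by lia, by lia, rfl, fun a ha0 haD => ?_, fun _ _ _ => rfl⟩
    rw [ht a ha0 haD]
    dsimp only
    split_ifs with hlt
    · rw [sieveVal_succ_of_not]
      rintro ⟨-, h⟩
      have := Nat.le_of_dvd (by lia) h
      lia
    · rfl

/-- If `M[13]` is a prime, treat its multiples. -/
def sieveRow : RAMProg :=
  .seq (.arith .add 19 13 30) <| .seq (.load 17 19) <| .seq (.arith .mod 17 9 17) <|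
  .seq (.ite 17 .skip <| .seq (.arith .add 15 13 8) <| .seq (.arith .div 16 12 13) <|
    .seq (.arith .sub 20 13 9) <| .loop 16 sieveStep) <|
  .seq (.arith .add 13 13 9) (.arith .sub 14 14 9)

/-- The test `1 % v` vanishes only for `v = 1`, since `1 % 0 = 1`; by `sieveVal_self_eq_one_iff` it
singles out the primes. -/
theorem sieveRow_spec {B p c : ℕ} {m : ℕ → ℕ} {o : List ℕ} (hg : Globals B m) (hp : 2 ≤ p)
    (hpD : p ≤ tableSize B) (h13 : m 13 = p) (h14 : m 14 = c) (hc : c ≤ B + 1)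
    (ht : Table B (sieveVal p) m) :
    Tri (opBound B) sieveRow m o
      ((11 * (opBound B).size + 22) * (tableSize B / p) + 11) fun m' o' => o' = o ∧
      Globals B m' ∧ m' 13 = p + 1 ∧ m' 14 = c - 1 ∧ Table B (sieveVal (p + 1)) m' := by
  have hN := opBound_eq B
  have hD := tableSize_le B
  have ⟨g8, g9, g10, g11, g12, g30⟩ := hg
  have hv := ht p (by lia) hpD
  have hvp := sieveVal_le p (a := p) (by lia)
  refine Tri.mono (k₁ := 1 + (1 + (1 + ((1 + (1 + (1 + (1 +
    ((11 * (opBound B).size + 22) * (tableSize B / p) + 1)))) + 1) + (1 + 1)))))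
    (Tri.arith_seq ?_ ?_ <| Tri.load_seq ?_ ?_ <| Tri.arith_seq ?_ ?_ <| Tri.seq_of
      (Tri.ite_add ?_ ?_ ?_ (P := fun m' o' => o' = o ∧
      Table B (sieveVal (p + 1)) m' ∧ ∀ i, 7 < i → i < 15 ∨ (20 < i ∧ i < 33) → m' i = m i))
      ?last) (by lia) (fun _ _ => id)
  case last =>
    rintro m' o' ⟨h1, h2, h3⟩
    have k9 : m' 9 = 1 := (h3 9 (by lia) (by lia)).trans g9
    have k13 : m' 13 = p := (h3 13 (by lia) (by lia)).trans h13
    have k14 : m' 14 = c := (h3 14 (by lia) (by lia)).trans h14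
    refine Tri.arith_seq ?_ ?_ <| Tri.arith ?_ ?_ ⟨h1, hg.congr fun i h h' => ?_, ?_, ?_,
      h2.congr fun i h => ?_⟩
    case refine_5 =>
      rw [← h3 i h (by lia)]
      simp [show i ≠ 13 by lia, show i ≠ 14 by lia]
    case refine_8 => simp [show i ≠ 13 by lia, show i ≠ 14 by lia]
    all_goals simp [ArithOp.eval, k9, k13, k14]
    all_goals lia
  all_goals simp [ArithOp.eval, g9, g30, h13, hv]
  · lia
  · lia
  · lia
  · lia
  · lia
  · lia
  · exact (Nat.mod_le _ _).trans (by lia)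
  · intro h
    refine Tri.skip ⟨rfl, fun a ha0 haD => ?_, fun i h1 h2 => ?_⟩
    · rw [sieveVal_succ_of_not, ← ht a ha0 haD]
      · simp
      · rintro ⟨h', -⟩
        rw [(sieveVal_self_eq_one_iff hp).2 h'] at h
        lia
    · simp [show i ≠ 17 by lia, show i ≠ 19 by lia]
  · intro h
    have hprime : p.Prime := (sieveVal_self_eq_one_iff hp).1 h
    have hdiv : tableSize B / p ≤ tableSize B := Nat.div_le_self _ _
    refine Tri.arith_seq ?_ ?_ <| Tri.arith_seq ?_ ?_ <| Tri.arith_seq ?_ ?_ <|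
      (sieveMultiples_spec (p := p) (hg.congr fun i h1 h2 => ?_) hprime hpD ?_ ?_ ?_ ?_
        (ht.congr fun i h1 => ?_)).mono le_rfl fun m' o' ⟨e1, e2, e3⟩ => ⟨e1, e2, fun i h1 h2 => ?_⟩
    case refine_7 => 
      simp [show i ≠ 15 by lia, show i ≠ 16 by lia, show i ≠ 17 by lia, show i ≠ 19 by lia,
        show i ≠ 20 by lia]
    case refine_12 => 
      simp [show i ≠ 15 by lia, show i ≠ 16 by lia, show i ≠ 17 by lia, show i ≠ 19 by lia,
        show i ≠ 20 by lia]
    case refine_13 => 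
      rw [e3 i h1 (by lia)]
      simp [show i ≠ 15 by lia, show i ≠ 16 by lia, show i ≠ 17 by lia, show i ≠ 19 by lia,
        show i ≠ 20 by lia]
    all_goals simp [ArithOp.eval, g8, g9, g12, h13]
    all_goals lia

/-- The initialization of the table, and the sieve. -/
def sieveProg : RAMProg :=
  .seq (.arith .add 13 12 8) <|
  .seq (.loop 13 <| .seq (.arith .add 19 13 30) <| .seq (.store 19 9) (.arith .sub 13 13 9)) <|
  .seq (.const 13 2) <| .seq (.arith .sub 14 12 9) <| .loop 14 sieveRow

/-- A bound for the time of `sieveProg`. -/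
def sieveTime (B : ℕ) : ℕ :=
  4 * tableSize B + 5 + ∑ p ∈ Finset.Ico 2 (tableSize B + 1),
    ((11 * (opBound B).size + 22) * (tableSize B / p) + 12)

theorem sieveProg_spec {B : ℕ} {m : ℕ → ℕ} {o : List ℕ} (hg : Globals B m) :
    Tri (opBound B) sieveProg m o (sieveTime B) fun m' o' => o' = o ∧ Globals B m' ∧
      Table B predLcm m' := by
  have hN := opBound_eq B
  have hD := tableSize_le B
  have hD1 : 1 ≤ tableSize B := Nat.le_add_left _ _
  have ⟨g8, g9, g10, g11, g12, g30⟩ := hg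
  refine Tri.mono (k₁ := 1 + ((4 * tableSize B + 1) + (1 + (1 + (∑ p ∈ Finset.Ico 2 (tableSize B + 1),
    ((11 * (opBound B).size + 22) * (tableSize B / p) + 12) + 1))))) (Tri.arith_seq ?_ ?_ <|
    Tri.seq_of (Tri.loop (fun b m' o' => 4 * m' 13 + 1 ≤ b ∧ m' 13 ≤ tableSize B ∧ o' = o ∧
      (∀ i, 7 < i → i < 13 ∨ i = 30 → m' i = m i) ∧
      ∀ a, m' 13 < a → a ≤ tableSize B → m' (a + 32) = 1)
      (P := fun m' o' => o' = o ∧ Globals B m' ∧ Table B (sieveVal 2) m') ?b1 ?e1 ?s1 ?i1) ?rest)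
    (by unfold sieveTime; lia) (fun _ _ => id)
  case b1 =>
    rintro b m' o' ⟨h1, h2, -⟩
    exact ⟨by lia, by lia⟩
  case e1 =>
    rintro b m' o' ⟨h1, h2, h3, h4, h5⟩ h0
    refine ⟨h3, hg.congr h4, fun a ha0 haD => ?_⟩
    rw [h5 a (by lia) haD, sieveVal_two]
  case s1 =>
    rintro b m' o' ⟨h1, h2, h3, h4, h5⟩ h0
    have f9 : m' 9 = 1 := (h4 9 (by lia) (by lia)).trans g9
    have f30 : m' 30 = 32 := (h4 30 (by lia) (by lia)).trans g30
    refine ⟨1 + (1 + 1), b - 4, by lia, Tri.arith_seq ?_ ?_ <| Tri.store_seq ?_ ?_ <|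
      Tri.arith ?_ ?_ ⟨?_, ?_, h3, fun i k1 k2 => ?_, fun a k1 k2 => ?_⟩⟩
    case refine_9 =>
      rw [← h4 i k1 k2]
      simp [ArithOp.eval, f30, show i ≠ 13 by lia, show i ≠ 19 by lia, show i ≠ m' 13 + 32 by lia]
    case refine_10 =>
      simp [ArithOp.eval, f9, f30] at k1 ⊢
      rw [Function.update_apply]
      split_ifs with h
      · rfl
      · simp [h5 a (by lia) k2]
    all_goals try simp [ArithOp.eval, f9, f30]
    all_goals lia
  case i1 =>
    refine ⟨?_, ?_, rfl, fun i k1 k2 => ?_, fun a k1 k2 => ?_⟩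
    · simp [ArithOp.eval, g8, g12]
    · simp [ArithOp.eval, g8, g12]
    · simp [show i ≠ 13 by lia]
    · simp [ArithOp.eval, g8, g12] at k1
      lia
  case rest =>
    rintro m' o' ⟨h1, h2, h3⟩
    have ⟨f8, f9, f10, f11, f12, f30⟩ := h2
    -- The time that is left is charged for all `q ≥ p`, prime or not: the harmonic sum costs only a
    -- logarithm.
    refine Tri.const_seq ?_ <| Tri.arith_seq ?_ ?_ <| Tri.loop (fun b m' o' =>
      ∃ p, 2 ≤ p ∧ m' 13 = p ∧ m' 14 = tableSize B + 1 - p ∧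
        ∑ q ∈ Finset.Ico p (tableSize B + 1),
        ((11 * (opBound B).size + 22) * (tableSize B / q) + 12) + 1 ≤ b ∧
        o' = o ∧ Globals B m' ∧ p ≤ tableSize B + 1 ∧ Table B (sieveVal p) m') ?b2 ?e2 ?s2 ?i2
    case b2 =>
      rintro b m' o' ⟨p, k1, k2, k3, k4, k5, k6, k7, k8⟩
      exact ⟨by lia, by lia⟩
    case e2 =>
      rintro b m' o' ⟨p, k1, k2, k3, k4, k5, k6, k7, k8⟩ h0
      refine ⟨k5, k6, fun a ha0 haD => ?_⟩
      rw [k8 a ha0 haD, sieveVal_of_lt (by lia) ha0]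
    case s2 =>
      rintro b m' o' ⟨p, k1, k2, k3, k4, k5, k6, k7, k8⟩ h0
      refine ⟨_, ∑ q ∈ Finset.Ico (p + 1) (tableSize B + 1),
        ((11 * (opBound B).size + 22) * (tableSize B / q) + 12) + 1, ?_,
        (sieveRow_spec k6 k1 (by lia) k2 k3 (by lia) k8).mono le_rfl ?_⟩
      · rw [Finset.sum_eq_sum_Ico_succ_bot (by lia)] at k4
        lia
      · rintro m₂ o₂ ⟨e1, e2, e3, e4, e5⟩
        exact ⟨p + 1, by lia, e3, by lia, le_rfl, e1.trans k5, e2, by lia, e5⟩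
    case i2 =>
      refine ⟨2, le_rfl, ?_, ?_, le_rfl, h1, h2.congr fun i k1 k2 => ?_, by lia,
        h3.congr fun i k1 => ?_⟩
      · simp
      · simp [ArithOp.eval, f9, f12]
      · simp [show i ≠ 13 by lia, show i ≠ 14 by lia]
      · simp [show i ≠ 13 by lia, show i ≠ 14 by lia]
    all_goals try simp [f9, f12]
    all_goals lia
  all_goals try simp [g8, g12]
  all_goals lia

end RAMProg

/-! ### Searching the multiples of one divisor. -/

namespace RAMProg

/-- Print `M[13] * M[15]` if it is a Carmichael number; `M[17]` is the table entry of `M[13]`. -/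
def testProg : RAMProg :=
  .seq (.arith .sub 18 15 9) <| .ite 18 (.seq (.arith .add 19 15 30) <| .seq (.load 20 19) <|
    .seq (.arith .mul 21 13 15) <| .seq (.arith .sub 21 21 9) <| .seq (.arith .mod 18 21 17) <|
    .ite 18 .skip <| .seq (.arith .mod 18 21 20) <| .ite 18 .skip <|
    .seq (.arith .add 1 13 8) <| .seq (.arith .add 2 15 8) <| .seq euclid <|
    .seq (.arith .sub 18 1 9) <| .ite 18 .skip <| .seq (.arith .add 21 21 9) (.print 21)) .skip

/-- A cofactor that is not squarefree has entry 0 and is rejected without a separate test, since `x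
% 0 = x`. -/
theorem testProg_spec {B d b : ℕ} {m : ℕ → ℕ} {o : List ℕ} (hg : Globals B m) (hd : 2 ≤ d)
    (hdD : d ≤ tableSize B) (hdb : d * b < B) (hbD : b ≤ tableSize B) (h13 : m 13 = d)
    (h15 : m 15 = b) (h17 : m 17 = predLcm d) (ht : Table B predLcm m) :
    Tri (opBound B) testProg m o (11 * (opBound B).size + 30) fun m' o' =>
      (∀ n, n ∈ o' ↔ n ∈ o ∨ (n = d * b ∧ 2 ≤ b ∧ IsCarmichael n)) ∧
      ∀ i, 7 < i → i < 18 ∨ 21 < i → m' i = m i := by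
  have hN := opBound_eq B
  have hD := tableSize_le B
  have ⟨g8, g9, g10, g11, g12, g30⟩ := hg
  refine Tri.mono (k₁ := 1 + ((1 + (1 + (1 + (1 + (1 + (1 +
      (1 + (1 + (1 + (1 + ((11 * (opBound B).size + 7) + (1 + (1 + (1 + 1) + 1))))) + 1)) + 1)))))) + 1 + 1))
    (Tri.arith_seq ?_ ?_ <| Tri.ite_add ?_ ?big ?_) (by lia) (fun _ _ => id)
  case big =>
    simp [ArithOp.eval, g9, h15]
    intro hb
    have hb0 : b ≠ 0 := by lia
    have hv := ht b hb0 hbD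
    have hvb := predLcm_le hb0
    have hvd := predLcm_le (a := d) (by lia)
    have hcar := isCarmichael_mul_iff hd (b := b) (by lia)
    refine Tri.mono (k₁ := (1 + (1 + (1 + (1 + (1 + (1 +
      (1 + (1 + (1 + (1 + ((11 * (opBound B).size + 7) + (1 + (1 + (1 + 1) + 1))))) + 1)) + 1))))))) (
      Tri.arith_seq ?_ ?_ <| Tri.load_seq ?_ ?_ <| Tri.arith_seq ?_ ?_ <|
      Tri.arith_seq ?_ ?_ <| Tri.arith_seq ?_ ?_ <| Tri.ite_add ?_ ?_ ?_) (by lia) (fun _ _ => id)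
    all_goals simp [ArithOp.eval, g9, g30, h15, h13, h17, hv]
    · lia
    · lia
    · lia
    · lia
    · lia
    · lia
    · lia
    · lia
    · lia
    · lia
    · exact (Nat.mod_le _ _).trans (by lia)
    · intro h
      refine Tri.skip ⟨fun n => ?_, fun i h1 h2 => ?_⟩
      · rw [iff_self_or]
        rintro ⟨rfl, h2, h3⟩
        exact absurd (Nat.mod_eq_zero_of_dvd (hcar.1 h3).1) h
      · simp [show i ≠ 18 by lia, show i ≠ 19 by lia, show i ≠ 20 by lia, show i ≠ 21 by lia]
    · intro hr1
      refine Tri.mono (k₁ :=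
        (1 + (1 + (1 + (1 + ((11 * (opBound B).size + 7) + (1 + (1 + (1 + 1) + 1))))) + 1)))
        (Tri.arith_seq ?_ ?_ <| Tri.ite_add ?_ ?_ ?_) (by lia) (fun _ _ => id)
      all_goals simp [ArithOp.eval]
      · lia
      · lia
      · exact (Nat.mod_le _ _).trans (by lia)
      · intro h
        refine Tri.skip ⟨fun n => ?_, fun i h1 h2 => ?_⟩
        · rw [iff_self_or]
          rintro ⟨rfl, h2, h3⟩
          exact absurd (Nat.mod_eq_zero_of_dvd (hcar.1 h3).2.1) h
        · simp [show i ≠ 18 by lia, show i ≠ 19 by lia, show i ≠ 20 by lia, show i ≠ 21 by lia]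
      · intro hr2
        have hb2 : (b + 1) ^ 2 ≤ opBound B := by nlinarith
        refine Tri.mono (k₁ :=
          (1 + (1 + ((11 * (opBound B).size + 7) + (1 + (1 + (1 + 1) + 1))))))
          (Tri.arith_seq ?_ ?_ <| Tri.arith_seq ?_ ?_ <| Tri.seq_of
            (euclid_spec ?_ ?_ ?_ ?_ ?_) ?rest) (by lia) (fun _ _ => id)
        case rest =>
          simp [ArithOp.eval, g8, h15, h13]
          rintro m' e1 - - ef
          have f : ∀ i, 7 < i → i < 18 ∨ 21 < i → m' i = m i := fun i h1 h2 => by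
            rw [ef i h1]
            simp [show i ≠ 1 by lia, show i ≠ 2 by lia, show i ≠ 18 by lia, show i ≠ 19 by lia,
              show i ≠ 20 by lia, show i ≠ 21 by lia]
          have f9 : m' 9 = 1 := (f 9 (by lia) (by lia)).trans g9
          have f21 : m' 21 = d * b - 1 := by
            rw [ef 21 (by lia)]
            simp
          have hgb : d.gcd b ≤ b := Nat.gcd_le_right _ (by lia)
          have hg0 : 0 < d.gcd b := Nat.gcd_pos_of_pos_left _ (by lia)
          refine Tri.mono (k₁ := 1 + (1 + (1 + 1) + 1)) (Tri.arith_seq ?_ ?_ <|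
            Tri.ite_add ?_ ?_ ?_) le_rfl (fun _ _ => id)
          all_goals simp [ArithOp.eval, e1, f9]
          · lia
          · lia
          · lia
          · intro h
            refine Tri.skip ⟨fun n => ?_, fun i h1 h2 => ?_⟩
            · rw [iff_self_or]
              rintro ⟨rfl, h2, h3⟩
              have := (hcar.1 h3).2.2
              lia
            · simp [show i ≠ 18 by lia, f i h1 h2]
          · intro h
            refine Tri.mono (k₁ := 1 + 1) (Tri.arith_seq ?_ ?_ <| Tri.print ?_
              ⟨fun n => ?_, fun i h1 h2 => ?_⟩) le_rfl (fun _ _ => id)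
            · simp [f21]
              lia
            · simp [f9]
              lia
            · simp [ArithOp.eval, f21, f9]
              lia
            · have h4 : 4 ≤ d * b := Nat.mul_le_mul hd (show 2 ≤ b by lia)
              have h5 : d * b - 1 + 1 = d * b := by lia
              have h6 : IsCarmichael (d * b) := hcar.2
                ⟨Nat.dvd_of_mod_eq_zero hr1, Nat.dvd_of_mod_eq_zero hr2, by lia⟩
              have h7 : n = d * b ↔ n = d * b ∧ 2 ≤ b ∧ IsCarmichael n :=
                ⟨fun h => ⟨h, by lia, h ▸ h6⟩, fun h => h.1⟩
              rw [← h7]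
              simp [ArithOp.eval, f21, f9, h5]
            · simp [show i ≠ 18 by lia, show i ≠ 21 by lia, f i h1 h2]
        all_goals simp [ArithOp.eval, g8, g9, h15, h13]
        all_goals lia
  all_goals simp [ArithOp.eval, g9, h15]
  · lia
  · lia
  · lia
  · intro h
    refine Tri.skip ⟨fun n => ?_, fun i h1 h2 => ?_⟩
    · rw [iff_self_or]
      lia
    · simp [show i ≠ 18 by lia]

end RAMProg

/-- `d` is a divisor whose multiples are searched for Carmichael numbers. -/
def Searched (B d : ℕ) : Prop :=
  predLcm d ≠ 0 ∧ (tableSize B < d * threshold B ∨ threshold B ≤ predLcm d)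

namespace RAMProg

/-- Print the Carmichael numbers among the multiples of `M[13]`, whose table entry is `M[17]`. -/
def searchProg : RAMProg :=
  .seq (.arith .add 1 13 8) <| .seq (.arith .add 2 17 8) <| .seq euclid <|
  .seq (.arith .sub 18 1 9) <| .ite 18 .skip <| .seq (.arith .add 15 4 8) <|
  .seq (.arith .mul 16 13 15) <| .seq (.arith .sub 16 10 16) <| .loop 16 <| .seq testProg <|
  .seq (.arith .add 15 15 17) <| .seq (.arith .mul 16 13 15) (.arith .sub 16 10 16)

/-- The rounded-up quotient counts the candidates that remain; it drops at the last step too, where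
the subtraction truncates. -/
theorem ceil_div_step {x m : ℕ} (hx : 0 < x) (hm : 0 < m) :
    (x - m + (m - 1)) / m + 1 ≤ (x + (m - 1)) / m := by
  rcases le_or_gt m x with h | h
  · rw [show x + (m - 1) = (x - m + (m - 1)) + m by lia, Nat.add_div_right _ hm]
  · rw [show x - m + (m - 1) = m - 1 by lia, Nat.div_eq_of_lt (by lia), Nat.le_div_iff_mul_le hm]
    lia

/-- The cofactor must be the inverse of `d` modulo `M = predLcm d`. The search starts at the least
representative found by `euclid` and advances by `M`. -/
theorem searchProg_spec {B d : ℕ} {m : ℕ → ℕ} {o : List ℕ} (hg : Globals B m) (hd : 2 ≤ d)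
    (hdD : d ≤ tableSize B) (hB : B ≠ 0) (hs : Searched B d) (h13 : m 13 = d)
    (h17 : m 17 = predLcm d) (ht : Table B predLcm m) :
    Tri (opBound B) searchProg m o ((11 * (opBound B).size + 34) * (B / (d * predLcm d) + 2))
      fun m' o' =>
      (∀ n, n ∈ o' ↔ n ∈ o ∨ (∃ b, n = d * b ∧ 2 ≤ b ∧ n < B ∧ IsCarmichael n)) ∧
      ∀ i, 7 < i → i < 15 ∨ 21 < i → m' i = m i := by
  have hN := opBound_eq B
  have hD := tableSize_le B
  have ⟨g8, g9, g10, g11, g12, g30⟩ := hg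
  obtain ⟨hM0, hcond⟩ := hs
  have hMd := predLcm_le (a := d) (by lia)
  have hcar : ∀ b, 2 ≤ b → IsCarmichael (d * b) → predLcm d ∣ d * b - 1 := fun b hb h =>
    ((isCarmichael_mul_iff hd hb).1 h).1
  have hcof : ∀ b, d * b < B → b ≤ tableSize B := fun b =>
    cofactor_le (threshold_pos B) (threshold_pow_three_le hB) rfl (by lia) hcond
  generalize hM : predLcm d = M at *
  have hdM : 0 < d * M := Nat.mul_pos (by lia) (by lia)
  have hdMB : d * M ≤ (B + 1) * (B + 1) := Nat.mul_le_mul (by lia) (by lia)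
  have hM2 : (M + 1) ^ 2 ≤ opBound B := by nlinarith
  set K := 11 * (opBound B).size + 34 with hK
  set q := B / (d * M) with hq
  refine Tri.mono (k₁ := 1 + (1 + ((11 * (opBound B).size + 7) + (1 + (1 + (1 + (1 + (1 +
    (K * (q + 1) + 1)))) + 1))))) (Tri.arith_seq ?_ ?_ <| Tri.arith_seq ?_ ?_ <| Tri.seq_of
      (euclid_spec ?_ ?_ ?_ ?_ ?_) ?rest) (by lia) (fun _ _ => id)
  case rest =>
    simp [ArithOp.eval, g8, h13, h17]
    rintro m' e1 e2 e3 ef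
    have f : ∀ i, 7 < i → m' i = m i := fun i h1 => by
      rw [ef i h1]
      simp [show i ≠ 1 by lia, show i ≠ 2 by lia]
    have f8 : m' 8 = 0 := (f 8 (by lia)).trans g8
    have f9 : m' 9 = 1 := (f 9 (by lia)).trans g9
    have f10 : m' 10 = B := (f 10 (by lia)).trans g10
    have f13 : m' 13 = d := (f 13 (by lia)).trans h13
    have f17 : m' 17 = M := (f 17 (by lia)).trans h17
    have hgb : d.gcd M ≤ M := Nat.gcd_le_right _ (by lia)
    have hg0 : 0 < d.gcd M := Nat.gcd_pos_of_pos_left _ (by lia)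
    refine Tri.mono (k₁ := 1 + (1 + (1 + (1 + (1 + (K * (q + 1) + 1)))) + 1))
      (Tri.arith_seq ?_ ?_ <| Tri.ite_add ?_ ?_ ?_) (by lia) (fun _ _ => id)
    all_goals simp [ArithOp.eval, e1, f9]
    · lia
    · lia
    · lia
    · intro h
      refine Tri.skip ⟨fun n => ?_, fun i h1 h2 => ?_⟩
      · rw [iff_self_or]
        rintro ⟨b, rfl, h2, h3, h4⟩
        -- A common divisor of `d` and `M` divides both `d * b` and `d * b - 1`; so if the gcd is
        -- not 1, nothing is to be found.
        have h5 := (Nat.gcd_dvd_right d M).trans (hcar b h2 h4)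
        have h6 : d.gcd M ∣ d * b := (Nat.gcd_dvd_left d M).mul_right b
        have h7 : 4 ≤ d * b := Nat.mul_le_mul hd h2
        have h8 := Nat.dvd_sub h6 h5
        rw [show d * b - (d * b - 1) = 1 by lia] at h8
        have := Nat.le_of_dvd one_pos h8
        lia
      · simp [show i ≠ 18 by lia, f i h1]
    · intro h
      have hgcd : d.gcd M = 1 := by lia
      rw [hgcd] at e3
      have huniq : ∀ b, 2 ≤ b → IsCarmichael (d * b) → ∀ c, c * d ≡ 1 [MOD M] → b ≡ c [MOD M] :=
        fun b hb h c hc => by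
          have h1 : 1 ≡ d * b [MOD M] :=
            (Nat.modEq_iff_dvd' (Nat.mul_pos (by lia) (by lia))).2 (hcar b hb h)
          refine Nat.ModEq.cancel_left_of_coprime ?_ (h1.symm.trans ((mul_comm d c) ▸ hc.symm))
          rw [Nat.gcd_comm]
          exact hgcd
      have hds : d * m' 4 ≤ (B + 1) * (B + 1) := Nat.mul_le_mul (by lia) (by lia)
      refine Tri.mono (k₁ := 1 + (1 + (1 + (K * (q + 1) + 1))))
        (Tri.arith_seq ?_ ?_ <| Tri.arith_seq ?_ ?_ <| Tri.arith_seq ?_ ?_ <| Tri.loop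
          (fun t m₂ o₂ => ∃ b, m₂ 15 = b ∧ m₂ 16 = B - d * b ∧
            K * ((B - d * b + (d * M - 1)) / (d * M)) + 1 ≤ t ∧ b * d ≡ 1 [MOD M] ∧
            (∀ n, n ∈ o₂ ↔ n ∈ o ∨ ∃ c < b, n = d * c ∧ 2 ≤ c ∧ n < B ∧ IsCarmichael n) ∧
            ∀ i, 7 < i → i < 15 ∨ i = 17 ∨ 21 < i → m₂ i = m i) ?bound ?exit ?step ?init)
          (by lia) (fun _ _ => id)
      case bound =>
        rintro t m₂ o₂ ⟨b, h1, h2, h3, -⟩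
        exact ⟨by lia, by lia⟩
      case exit =>
        rintro t m₂ o₂ ⟨b, h1, h2, h3, h4, h5, h6⟩ h0
        refine ⟨fun n => (h5 n).trans (or_congr_right ⟨fun ⟨c, _, h⟩ => ⟨c, h⟩, ?_⟩),
          fun i k1 k2 => h6 i k1 (by lia)⟩
        rintro ⟨c, rfl, k1, k2, k3⟩
        exact ⟨c, lt_of_mul_lt_mul_left (a := d) (by lia) (Nat.zero_le _), rfl, k1, k2, k3⟩
      case step =>
        rintro t m₂ o₂ ⟨b, h1, h2, h3, h4, h5, h6⟩ h0
        have hbB : d * b < B := by lia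
        have hbD := hcof b hbB
        have hcs := ceil_div_step (x := B - d * b) (m := d * M) (by lia) hdM
        have hmul : d * (b + M) = d * b + d * M := by ring
        rw [Nat.sub_sub, ← hmul] at hcs
        have hK3 := Nat.mul_le_mul_left K hcs
        have k10 : m₂ 10 = B := (h6 10 (by lia) (by lia)).trans g10
        have k13 : m₂ 13 = d := (h6 13 (by lia) (by lia)).trans h13
        have k17 : m₂ 17 = M := (h6 17 (by lia) (by lia)).trans h17
        refine ⟨(11 * (opBound B).size + 30) + (1 + (1 + 1)),
          K * ((B - d * (b + M) + (d * M - 1)) / (d * M)) + 1, by lia, Tri.seq_of (testProg_spec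
          (hg.congr fun i l1 l2 => h6 i l1 (by lia)) hd hdD hbB hbD k13 h1 (k17.trans hM.symm)
          (ht.congr fun i l => h6 i (by lia) (by lia))) ?_⟩
        rintro m₃ o₃ ⟨l1, l2⟩
        have j10 : m₃ 10 = B := (l2 10 (by lia) (by lia)).trans k10
        have j13 : m₃ 13 = d := (l2 13 (by lia) (by lia)).trans k13
        have j15 : m₃ 15 = b := (l2 15 (by lia) (by lia)).trans h1
        have j17 : m₃ 17 = M := (l2 17 (by lia) (by lia)).trans k17
        refine Tri.arith_seq ?_ ?_ <| Tri.arith_seq ?_ ?_ <| Tri.arith ?_ ?_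
          ⟨b + M, ?_, ?_, le_rfl, ?_, fun n => ?out, fun i n1 n2 => ?frame⟩
        case frame =>
          rw [← h6 i n1 n2, ← l2 i n1 (by lia)]
          simp [show i ≠ 15 by lia, show i ≠ 16 by lia]
        case out =>
          rw [l1 n, h5 n, or_assoc]
          refine or_congr_right ?_
          constructor
          · rintro (⟨c, n1, n2, n3⟩ | ⟨rfl, n2, n3⟩)
            · exact ⟨c, by lia, n2, n3⟩
            · exact ⟨b, by lia, rfl, n2, hbB, n3⟩
          · rintro ⟨c, n1, rfl, n2, n3, n4⟩
            rcases lt_or_ge c b with hcb | hcb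
            · exact .inl ⟨c, hcb, rfl, n2, n3, n4⟩
            -- A solution in `[b, b + M)` is congruent to `b` modulo `M`, hence equal to it.
            · obtain rfl : b = c := by
                have n5 := (Nat.modEq_iff_dvd' hcb).1 (huniq c n2 n4 b h4).symm
                by_contra hne
                have := Nat.le_of_dvd (by lia) n5
                lia
              exact .inr ⟨rfl, n2, n4⟩
        case refine_9 =>
          rw [add_mul]
          exact (Nat.ModEq.add_left _ (Nat.modEq_zero_iff_dvd.2 (Dvd.intro _ rfl))).trans h4
        all_goals simp [ArithOp.eval, j10, j13, j15, j17]
        all_goals lia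
      case init =>
        refine ⟨m' 4, ?_, ?_, ?_, e3, fun n => ?_, fun i n1 n2 => ?_⟩
        · simp [ArithOp.eval, f8]
        · simp [ArithOp.eval, f8, f10, f13]
        · refine Nat.succ_le_succ (Nat.mul_le_mul_left _ ?_)
          rw [hq, ← Nat.add_div_right _ hdM]
          exact Nat.div_le_div_right (by lia)
        · rw [iff_self_or]
          rintro ⟨c, h1, rfl, h2, h3, h4⟩
          -- No solution precedes the starting point, which is the reduced residue.
          have h5 := huniq c h2 h4 _ e3
          rw [Nat.ModEq, Nat.mod_eq_of_lt (h1.trans e2), Nat.mod_eq_of_lt e2] at h5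
          lia
        · rw [← f i n1]
          simp [show i ≠ 15 by lia, show i ≠ 16 by lia, show i ≠ 18 by lia]
      all_goals simp [ArithOp.eval, f8, f10, f13]
      all_goals lia
  all_goals simp [ArithOp.eval, g8, g9, h13, h17]
  all_goals lia

end RAMProg

/-- `n` is a Carmichael number below `B` that is found by the treatment of `d`. -/
def FoundFrom (B d n : ℕ) : Prop :=
  n < B ∧ IsCarmichael n ∧ (n = d ∨ (Searched B d ∧ ∃ b, n = d * b ∧ 2 ≤ b))

/-- A number within the table is found as its own `d`, a larger one by
`IsCarmichael.exists_divisor`; there `predLcm d` is nonzero because it divides `d * b - 1 > 0`. -/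
theorem exists_foundFrom_iff {B n : ℕ} :
    (∃ d, 2 ≤ d ∧ d ≤ tableSize B ∧ FoundFrom B d n) ↔ IsCarmichael n ∧ n < B := by
  constructor
  · rintro ⟨d, -, -, h1, h2, -⟩
    exact ⟨h2, h1⟩
  · rintro ⟨h1, h2⟩
    by_cases h3 : n ≤ tableSize B
    · exact ⟨n, h1.1, h3, h2, h1, .inl rfl⟩
    · obtain ⟨d, b, rfl, h4, h5, h6, h7⟩ := h1.exists_divisor h2 (threshold_pos B)
        (threshold_pow_three_le (by lia)) (D := tableSize B) rfl (by lia)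
      refine ⟨d, h4, h5, h2, h1, .inr ⟨⟨fun h8 => ?_, h7⟩, b, rfl, h6⟩⟩
      have h9 := ((isCarmichael_mul_iff h4 h6).1 h1).1
      have h10 : 4 ≤ d * b := Nat.mul_le_mul h4 h6
      rw [h8, zero_dvd_iff] at h9
      lia

/-! ### The complete program. -/

namespace RAMProg

/-- Print the Carmichael numbers that are found by the treatment of `M[14] + 1`. -/
def mainRow : RAMProg :=
  .seq (.arith .add 13 14 9) <| .seq (.arith .add 19 13 30) <| .seq (.load 17 19) <|
  .seq (.arith .mod 18 14 17) <|
  .seq (.ite 18 .skip <| .seq (.arith .sub 18 14 17) <| .ite 18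
    (.seq (.arith .sub 18 10 13) <| .ite 18 (.print 13) .skip) .skip) <|
  .seq (.ite 17 (.seq (.arith .mul 18 13 11) <| .seq (.arith .sub 18 18 12) <|
    .seq (.arith .add 20 17 9) <| .seq (.arith .sub 20 20 11) <| .seq (.arith .add 18 18 20) <|
    .ite 18 searchProg .skip) .skip) <|
  .arith .sub 14 14 9

/-- A bound for the time of `mainRow` for the divisor `d`. -/
noncomputable def rowTime (B d : ℕ) : ℕ :=
  open Classical in
  23 + if Searched B d then (11 * (opBound B).size + 34) * (B / (d * predLcm d) + 2) else 0

/-- Comparisons are nonzero truncated differences. The sum of `d * T - D` and `predLcm d + 1 - T` is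
nonzero iff one of the two alternatives of `Searched` holds. -/
theorem mainRow_spec {B d : ℕ} {m : ℕ → ℕ} {o : List ℕ} (hg : Globals B m) (hd : 2 ≤ d)
    (hdD : d ≤ tableSize B) (hB : B ≠ 0) (h14 : m 14 = d - 1) (ht : Table B predLcm m) :
    Tri (opBound B) mainRow m o (rowTime B d) fun m' o' =>
      (∀ n, n ∈ o' ↔ n ∈ o ∨ FoundFrom B d n) ∧ Globals B m' ∧ Table B predLcm m' ∧
      m' 14 = d - 2 := by
  classical
  have hN := opBound_eq B
  have hD := tableSize_le B
  have hT := threshold_le B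
  have ⟨g8, g9, g10, g11, g12, g30⟩ := hg
  have hv := ht d (by lia) hdD
  have hvd := predLcm_le (a := d) (by lia)
  have hcar := isCarmichael_iff_lt (n := d) (by lia)
  have hdT : d * threshold B ≤ (B + 1) * (B + 1) := Nat.mul_le_mul (by lia) hT
  have hd1 : d - 1 + 1 = d := by lia
  refine Tri.mono (k₁ := 1 + (1 + (1 + (1 + ((1 + (1 + ((1 + (1 + 1 + 1)) + 1 + 1)) + 1) + ((
    (rowTime B d - 16) + 1 + 1) + 1)))))) (Tri.arith_seq ?_ ?_ <| Tri.arith_seq ?_ ?_ <|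
    Tri.load_seq ?_ ?_ <| Tri.arith_seq ?_ ?_ <| Tri.seq_of (Tri.ite_add ?_ ?_ ?_
      (P := fun m' o' => (∀ n, n ∈ o' ↔ n ∈ o ∨ (n < B ∧ IsCarmichael n ∧ n = d)) ∧
        m' 17 = predLcm d ∧ m' 13 = d ∧
        ∀ i, 7 < i → i < 13 ∨ i = 14 ∨ 21 < i → m' i = m i)) ?rest) ?_ (fun _ _ => id)
  case rest =>
    rintro m' o' ⟨h1, h17, h13, h2⟩
    have f9 : m' 9 = 1 := (h2 9 (by lia) (by lia)).trans g9
    have f11 : m' 11 = threshold B := (h2 11 (by lia) (by lia)).trans g11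
    have f12 : m' 12 = tableSize B := (h2 12 (by lia) (by lia)).trans g12
    have f14 : m' 14 = d - 1 := (h2 14 (by lia) (by lia)).trans h14
    refine Tri.seq_of (Tri.ite_add ?_ ?yes ?no (P := fun m' o' =>
      (∀ n, n ∈ o' ↔ n ∈ o ∨ FoundFrom B d n) ∧
        ∀ i, 7 < i → i < 13 ∨ i = 14 ∨ 21 < i → m' i = m i)) ?last
    case last =>
      rintro m₂ o₂ ⟨h3, h4⟩
      have k9 : m₂ 9 = 1 := (h4 9 (by lia) (by lia)).trans g9
      have k14 : m₂ 14 = d - 1 := (h4 14 (by lia) (by lia)).trans h14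
      refine Tri.arith ?_ ?_ ⟨h3, hg.congr fun i n1 n2 => ?_, ht.congr fun i n1 => ?_, ?_⟩
      · lia
      · lia
      · rw [← h4 i n1 (by lia)]
        simp [show i ≠ 14 by lia]
      · rw [← h4 i (by lia) (by lia)]
        simp [show i ≠ 14 by lia]
      · simp [ArithOp.eval, k9, k14]
        lia
    case no =>
      intro h
      refine Tri.skip ⟨fun n => (h1 n).trans (or_congr_right ?_), h2⟩
      refine ⟨fun ⟨l1, l2, l3⟩ => ⟨l1, l2, .inl l3⟩, ?_⟩
      rintro ⟨l1, l2, l3 | ⟨l3, -⟩⟩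
      · exact ⟨l1, l2, l3⟩
      · exact absurd (h17.symm.trans h) l3.1
    case yes =>
      intro hne
      rw [h17] at hne
      refine Tri.mono (k₁ := 1 + (1 + (1 + (1 + (1 + ((rowTime B d - 23) + 1 + 1))))))
        (Tri.arith_seq ?_ ?_ <| Tri.arith_seq ?_ ?_ <| Tri.arith_seq ?_ ?_ <|
        Tri.arith_seq ?_ ?_ <| Tri.arith_seq ?_ ?_ <| Tri.ite_add ?_ ?_ ?_)
        (by unfold rowTime; lia) (fun _ _ => id)
      all_goals simp [ArithOp.eval, f9, f11, f12, h13, h17]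
      · lia
      · lia
      · lia
      · lia
      · lia
      · lia
      · lia
      · lia
      · lia
      · lia
      · lia
      · intro h
        have hs : Searched B d := ⟨hne, by lia⟩
        refine (searchProg_spec (hg.congr fun i n1 n2 => ?_) hd hdD hB hs ?_ ?_
          (ht.congr fun i n1 => ?_)).mono ?_ fun m₂ o₂ ⟨e1, e2⟩ => ⟨fun n => ?_, fun i n1 n2 => ?_⟩
        · rw [← h2 i n1 (by lia)]
          simp [show i ≠ 18 by lia, show i ≠ 20 by lia]
        · simp [h13]
        · simp [h17]
        · rw [← h2 i (by lia) (by lia)]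
          simp [show i ≠ 18 by lia, show i ≠ 20 by lia]
        · unfold rowTime
          rw [if_pos hs]
          lia
        · rw [e1 n, h1 n, or_assoc, FoundFrom]
          refine or_congr_right ?_
          constructor
          · rintro (⟨l1, l2, l3⟩ | ⟨b, l1, l2, l3, l4⟩)
            · exact ⟨l1, l2, .inl l3⟩
            · exact ⟨l3, l4, .inr ⟨hs, b, l1, l2⟩⟩
          · rintro ⟨l1, l2, l3 | ⟨-, b, l3, l4⟩⟩
            · exact .inl ⟨l1, l2, l3⟩
            · exact .inr ⟨b, l3, l4, l1, l2⟩
        · rw [e2 i n1 (by lia), ← h2 i n1 n2]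
          simp [show i ≠ 18 by lia, show i ≠ 20 by lia]
      · intro h h'
        refine Tri.skip ⟨fun n => (h1 n).trans (or_congr_right ?_), fun i n1 n2 => ?_⟩
        · refine ⟨fun ⟨l1, l2, l3⟩ => ⟨l1, l2, .inl l3⟩, ?_⟩
          rintro ⟨l1, l2, l3 | ⟨⟨l3, l4⟩, -⟩⟩
          · exact ⟨l1, l2, l3⟩
          · lia
        · rw [← h2 i n1 n2]
          simp [show i ≠ 18 by lia, show i ≠ 20 by lia]
    · lia
  all_goals try simp [ArithOp.eval, g9, g30, h14, hd1, hv]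
  · lia
  · lia
  · lia
  · lia
  · lia
  · lia
  · lia
  · lia
  · exact (Nat.mod_le _ _).trans (by lia)
  · intro h
    refine Tri.skip ⟨fun n => ?_, ?_, ?_, fun i n1 n2 => ?_⟩
    · rw [iff_self_or]
      rintro ⟨l1, l2, rfl⟩
      exact absurd (Nat.mod_eq_zero_of_dvd (hcar.1 l2).1) h
    · simp
    · simp
    · simp [show i ≠ 13 by lia, show i ≠ 17 by lia, show i ≠ 18 by lia, show i ≠ 19 by lia]
  · intro hr
    refine Tri.mono (k₁ := 1 + ((1 + (1 + 1 + 1)) + 1 + 1))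
      (Tri.arith_seq ?_ ?_ <| Tri.ite_add ?_ ?_ ?_) (by lia) (fun _ _ => id)
    all_goals simp [ArithOp.eval, h14]
    · lia
    · lia
    · lia
    · intro h
      refine Tri.mono (k₁ := 1 + (1 + 1 + 1))
        (Tri.arith_seq ?_ ?_ <| Tri.ite_add ?_ ?_ ?_) (by lia) (fun _ _ => id)
      all_goals simp [ArithOp.eval, g10]
      · lia
      · lia
      · lia
      · intro h'
        refine Tri.print ?_ ⟨fun n => ?_, ?_, ?_, fun i n1 n2 => ?_⟩
        · simp
          lia
        · have h7 : n = d ↔ n < B ∧ IsCarmichael n ∧ n = d :=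
            ⟨fun h => ⟨by lia, h ▸ hcar.2 ⟨Nat.dvd_of_mod_eq_zero hr, by lia⟩, h⟩, fun h => h.2.2⟩
          rw [← h7]
          simp
        · simp
        · simp
        · simp [show i ≠ 13 by lia, show i ≠ 17 by lia, show i ≠ 18 by lia, show i ≠ 19 by lia]
      · intro h'
        refine Tri.skip ⟨fun n => ?_, ?_, ?_, fun i n1 n2 => ?_⟩
        · rw [iff_self_or]
          lia
        · simp
        · simp
        · simp [show i ≠ 13 by lia, show i ≠ 17 by lia, show i ≠ 18 by lia, show i ≠ 19 by lia]
    · intro h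
      refine Tri.skip ⟨fun n => ?_, ?_, ?_, fun i n1 n2 => ?_⟩
      · rw [iff_self_or]
        rintro ⟨l1, l2, rfl⟩
        have := (hcar.1 l2).2
        lia
      · simp
      · simp
      · simp [show i ≠ 13 by lia, show i ≠ 17 by lia, show i ≠ 18 by lia, show i ≠ 19 by lia]
  · unfold rowTime
    lia

/-- The program that lists the Carmichael numbers below its input. -/
def carmichaelList : RAMProg :=
  .seq (.arith .add 10 0 8) <| .seq (.const 9 1) <| .seq (.const 30 32) <|
  .seq (.call 11 thresholdProg 10) <| .seq (.arith .div 12 10 11) <| .seq (.arith .add 12 12 9) <|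
  .seq sieveProg <| .seq (.arith .sub 14 12 9) <| .loop 14 mainRow

/-- A bound for the time of `carmichaelList`. -/
noncomputable def listTime (B : ℕ) : ℕ :=
  12 * (opBound B).size + 32 + sieveTime B +
    ∑ d ∈ Finset.Ico 2 (tableSize B + 1), (rowTime B d + 1)

theorem carmichaelList_spec (B : ℕ) :
    Tri (opBound B) carmichaelList (initMem B) [] (listTime B) fun _ o =>
      ∀ n, n ∈ o ↔ IsCarmichael n ∧ n < B := by
  have hN := opBound_eq B
  have hD := tableSize_le B
  have hD1 : 1 ≤ tableSize B := Nat.le_add_left _ _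
  have hT := threshold_le B
  have hdiv : B / threshold B ≤ B := Nat.div_le_self _ _
  refine Tri.mono (k₁ := 1 + (1 + (1 + ((12 * (opBound B).size + 24 + 1) + (1 + (1 +
    (sieveTime B + (1 + (∑ d ∈ Finset.Ico 2 (tableSize B + 1), (rowTime B d + 1) + 1)))))))))
    (Tri.arith_seq ?_ ?_ <| Tri.const_seq ?_ <| Tri.const_seq ?_ <| Tri.seq <| Tri.call ?_ <|
      Tri.mono (thresholdProg_spec (B := B) ?_) le_rfl ?_)
    (by unfold listTime; lia) (fun _ _ => id)
  case refine_6 =>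
    rw [opBound]
    exact Nat.pow_le_pow_left (by lia) 2
  case refine_7 =>
    intro m' o' h
    refine ⟨by lia, Tri.arith_seq ?_ ?_ <| Tri.arith_seq ?_ ?_ <| Tri.seq_of (sieveProg_spec ?_)
      ?rest⟩
    case refine_5 =>
      constructor
      all_goals simp [initMem, ArithOp.eval, h, tableSize]
    case rest =>
      rintro m₁ o₁ ⟨rfl, hg, ht⟩
      -- The divisors are treated downwards from `tableSize B`; those above `d` are done, and `d =
      -- 1` ends the loop.
      refine Tri.arith_seq ?_ ?_ <| Tri.loop (fun t m₂ o₂ => ∃ d, d ≤ tableSize B ∧ 1 ≤ d ∧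
        m₂ 14 = d - 1 ∧ ∑ d ∈ Finset.Ico 2 (d + 1), (rowTime B d + 1) + 1 ≤ t ∧
        Globals B m₂ ∧ Table B predLcm m₂ ∧
        ∀ n, n ∈ o₂ ↔ ∃ e, d < e ∧ e ≤ tableSize B ∧ FoundFrom B e n) ?_ ?_ ?_ ?_
      · rw [hg.len]; lia
      · rw [hg.one]; lia
      · rintro t m₂ o₂ ⟨d, h1, h2, h3, h4, -⟩
        exact ⟨by lia, by lia⟩
      · rintro t m₂ o₂ ⟨d, h1, h2, h3, h4, h5, h6, h7⟩ h0 n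
        obtain rfl : d = 1 := by lia
        rw [h7 n, ← exists_foundFrom_iff]
        rfl
      · rintro t m₂ o₂ ⟨d, h1, h2, h3, h4, h5, h6, h7⟩ h0
        have hB : B ≠ 0 := by
          rintro rfl
          simp [tableSize] at h1
          lia
        rw [Finset.sum_Ico_succ_top (by lia)] at h4
        refine ⟨_, ∑ d ∈ Finset.Ico 2 d, (rowTime B d + 1) + 1, by lia,
          (mainRow_spec h5 (d := d) (by lia) h1 hB h3 h6).mono le_rfl ?_⟩
        rintro m₃ o₃ ⟨e1, e2, e3, e4⟩
        refine ⟨d - 1, by lia, by lia, by lia, ?_, e2, e3, fun n => ?_⟩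
        · rw [Nat.sub_add_cancel h2]
        · rw [e1 n, h7 n]
          constructor
          · rintro (⟨e, k1, k2, k3⟩ | k)
            · exact ⟨e, by lia, k2, k3⟩
            · exact ⟨d, by lia, h1, k⟩
          · rintro ⟨e, k1, k2, k3⟩
            rcases eq_or_ne e d with rfl | hne
            · exact .inr k3
            · exact .inl ⟨e, by lia, k2, k3⟩
      · refine ⟨tableSize B, le_rfl, hD1, ?_, le_rfl, hg.congr fun i k1 k2 => ?_,
          ht.congr fun i k1 => ?_, fun n => ?_⟩
        · simp [ArithOp.eval, hg.len, hg.one]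
        · simp [show i ≠ 14 by lia]
        · simp [show i ≠ 14 by lia]
        · simp
          lia
    all_goals simp [initMem, ArithOp.eval, h]
    all_goals lia
  all_goals try simp [initMem, ArithOp.eval]
  all_goals lia

theorem carmichaelList_deterministic : carmichaelList.Deterministic := by
  simp [carmichaelList, Deterministic, thresholdProg, sizeProg, sieveProg, sieveRow, sieveStep,
    euclid, euclidStep, mainRow, searchProg, testProg]

end RAMProg

/-! ### Sums over primes and Rankin's method. -/

open Chebyshev in
-- On a dyadic block `1 / p ≤ log p / (2 ^ j * j * log 2)`, and Chebyshev's bound `θ(x) ≤ x * log 4`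
-- applies to the numerators.
theorem sum_inv_primes_block_le {j : ℕ} (hj : j ≠ 0) :
    ∑ p ∈ (Finset.Ico (2 ^ j) (2 ^ (j + 1))).filter Nat.Prime, (p : ℝ)⁻¹ ≤ 4 * (j : ℝ)⁻¹ := by
  have hj0 : (0 : ℝ) < j := by exact_mod_cast Nat.pos_of_ne_zero hj
  have hl2 : 0 < Real.log 2 := Real.log_pos one_lt_two
  have h1 : ∀ p ∈ (Finset.Ico (2 ^ j) (2 ^ (j + 1))).filter Nat.Prime,
      (p : ℝ)⁻¹ ≤ Real.log p / (2 ^ j * (j * Real.log 2)) := by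
    intro p hp
    simp only [Finset.mem_filter, Finset.mem_Ico] at hp
    have h2 : (2 : ℝ) ^ j ≤ p := by exact_mod_cast hp.1.1
    have h3 : j * Real.log 2 ≤ Real.log p := by
      rw [← Real.log_pow]
      exact Real.log_le_log (by positivity) h2
    calc (p : ℝ)⁻¹ ≤ (2 ^ j : ℝ)⁻¹ * 1 := by
          rw [mul_one]
          exact inv_anti₀ (by positivity) h2
      _ ≤ (2 ^ j : ℝ)⁻¹ * (Real.log p / (j * Real.log 2)) := by
          gcongr
          rwa [one_le_div (by positivity)]
      _ = _ := by field_simp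
  have h4 : ∑ p ∈ (Finset.Ico (2 ^ j) (2 ^ (j + 1))).filter Nat.Prime, Real.log p ≤
      Real.log 4 * 2 ^ (j + 1) := by
    have h5 := theta_le_log4_mul_x (x := ((2 ^ (j + 1) : ℕ) : ℝ)) (by positivity)
    rw [theta_eq_sum_primesLE_log] at h5
    push_cast at h5
    refine le_trans (Finset.sum_le_sum_of_subset_of_nonneg (fun p hp => ?_) fun p hp _ => ?_) h5
    · simp only [Finset.mem_filter, Finset.mem_Ico, Nat.mem_primesLE] at hp ⊢
      exact ⟨hp.1.2.le, hp.2⟩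
    · exact Real.log_natCast_nonneg p
  calc _ ≤ ∑ p ∈ (Finset.Ico (2 ^ j) (2 ^ (j + 1))).filter Nat.Prime,
        Real.log p / (2 ^ j * (j * Real.log 2)) := Finset.sum_le_sum h1
    _ = (∑ p ∈ (Finset.Ico (2 ^ j) (2 ^ (j + 1))).filter Nat.Prime, Real.log p) /
        (2 ^ j * (j * Real.log 2)) := by rw [Finset.sum_div]
    _ ≤ (Real.log 4 * 2 ^ (j + 1)) / (2 ^ j * (j * Real.log 2)) := by gcongr
    _ = _ := by
        rw [show (4 : ℝ) = 2 ^ 2 by norm_num, Real.log_pow, pow_succ]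
        field_simp
        norm_num

/-- A weak form of the upper bound in Mertens' second theorem. -/
theorem sum_inv_primesBelow_two_pow_le (J : ℕ) :
    ∑ p ∈ Nat.primesBelow (2 ^ J), (p : ℝ)⁻¹ ≤ 4 * (1 + Real.log J) := by
  have key : ∀ J : ℕ, ∑ p ∈ Nat.primesBelow (2 ^ (J + 1)), (p : ℝ)⁻¹ ≤ 4 * (harmonic J : ℝ) := by
    intro J
    induction J with
    | zero => simp [Nat.primesBelow, Finset.sum_filter, Finset.sum_range_succ, Nat.not_prime_zero,
        Nat.not_prime_one]
    | succ J ih =>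
      have h1 : Nat.primesBelow (2 ^ (J + 1 + 1)) = Nat.primesBelow (2 ^ (J + 1)) ∪
          (Finset.Ico (2 ^ (J + 1)) (2 ^ (J + 1 + 1))).filter Nat.Prime := by
        ext p
        simp only [Nat.mem_primesBelow, Finset.mem_union, Finset.mem_filter, Finset.mem_Ico]
        have : 2 ^ (J + 1) ≤ 2 ^ (J + 1 + 1) := Nat.pow_le_pow_right two_pos (by lia)
        constructor
        · rintro ⟨h, hp⟩
          by_cases h' : p < 2 ^ (J + 1)
          · exact .inl ⟨h', hp⟩
          · exact .inr ⟨⟨by lia, h⟩, hp⟩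
        · rintro (⟨h, hp⟩ | ⟨⟨h, h'⟩, hp⟩)
          · exact ⟨by lia, hp⟩
          · exact ⟨h', hp⟩
      rw [h1, harmonic_succ]
      refine (Finset.sum_union_inter (f := fun p : ℕ => (p : ℝ)⁻¹) ▸
        le_add_of_nonneg_right (Finset.sum_nonneg fun p _ => by positivity)).trans ?_
      push_cast
      rw [mul_add]
      refine add_le_add ih ?_
      simpa using sum_inv_primes_block_le J.succ_ne_zero
  rcases J with _ | J
  · simp [Nat.primesBelow, Nat.not_prime_zero, Finset.sum_filter]
  · refine (key J).trans ?_
    have h1 := harmonic_le_one_add_log J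
    have h2 : Real.log J ≤ Real.log (J + 1 : ℕ) := by
      rcases Nat.eq_zero_or_pos J with rfl | hJ
      · simp
      · exact Real.log_le_log (by exact_mod_cast hJ) (by push_cast; linarith)
    linarith

theorem two_pow_card_primeFactors_le {f : ℕ} (hf : f ≠ 0) : 2 ^ f.primeFactors.card ≤ f :=
  calc 2 ^ f.primeFactors.card ≤ ∏ p ∈ f.primeFactors, p :=
        Finset.pow_card_le_prod _ _ _ fun _ hp => (Nat.prime_of_mem_primeFactors hp).two_le
    _ ≤ f := Nat.le_of_dvd (Nat.pos_of_ne_zero hf) (Nat.prod_primeFactors_dvd f)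

/-- Primes `q < 2 ^ J` satisfy `q ^ s ≤ (2 ^ J) ^ s` and are summed by Mertens; there are at most `2
^ J` others, each contributing at most `(2 ^ J) ^ (s - 1)`. -/
theorem sum_primeFactors_rpow_le {f J : ℕ} {s : ℝ} (hf : f ≠ 0) (hfJ : f < 2 ^ 2 ^ J)
    (h0 : 0 ≤ s) (h1 : s ≤ 1) :
    ∑ q ∈ f.primeFactors, (q : ℝ) ^ (s - 1) ≤ ((2 : ℝ) ^ J) ^ s * (4 * (1 + Real.log J) + 1) := by
  have hcard : f.primeFactors.card ≤ 2 ^ J :=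
    ((Nat.pow_lt_pow_iff_right one_lt_two).1 ((two_pow_card_primeFactors_le hf).trans_lt hfJ)).le
  have hterm : ∀ q ∈ f.primeFactors, (q : ℝ) ^ (s - 1) ≤
      (if q < 2 ^ J then ((2 : ℝ) ^ J) ^ s * (q : ℝ)⁻¹ else 0) + ((2 : ℝ) ^ J) ^ s / 2 ^ J := by
    intro q hq
    have hq0 : (0 : ℝ) < q := by exact_mod_cast (Nat.prime_of_mem_primeFactors hq).pos
    split_ifs with h
    · rw [Real.rpow_sub_one hq0.ne', div_eq_mul_inv]
      refine le_add_of_le_of_nonneg ?_ (by positivity)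
      gcongr
      exact_mod_cast h.le
    · rw [zero_add, ← Real.rpow_sub_one (by positivity)]
      refine Real.rpow_le_rpow_of_nonpos (by positivity) ?_ (by linarith)
      exact_mod_cast not_lt.1 h
  refine (Finset.sum_le_sum hterm).trans ?_
  rw [Finset.sum_add_distrib, mul_add, mul_one, Finset.sum_const, nsmul_eq_mul, ← Finset.sum_filter,
    ← Finset.mul_sum]
  refine add_le_add (mul_le_mul_of_nonneg_left ?_ (by positivity)) ?_
  · refine le_trans (Finset.sum_le_sum_of_subset_of_nonneg (fun q hq => ?_) fun q _ _ => ?_)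
      (sum_inv_primesBelow_two_pow_le J)
    · simp only [Finset.mem_filter, Nat.mem_primesBelow] at hq ⊢
      exact ⟨hq.2, Nat.prime_of_mem_primeFactors hq.1⟩
    · positivity
  · have : (f.primeFactors.card : ℝ) ≤ 2 ^ J := by exact_mod_cast hcard
    calc _ ≤ (2 : ℝ) ^ J * (((2 : ℝ) ^ J) ^ s / 2 ^ J) := by gcongr
      _ = _ := by field_simp

/-- The completely multiplicative function `n ↦ n ^ (s - 1)`. -/
noncomputable def rpowHom (s : ℝ) : ℕ →* ℝ where
  toFun n := (n : ℝ) ^ (s - 1)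
  map_one' := by simp
  map_mul' m n := by
    push_cast
    exact Real.mul_rpow (Nat.cast_nonneg m) (Nat.cast_nonneg n)

/-- For `s ≤ 1 / 2` this keeps the Euler factors `1 / (1 - u)` away from the pole; `u ≤ 3 / 4` makes
them at most `exp (4 * u)`. -/
theorem rpow_sub_one_le {p : ℕ} {s : ℝ} (hp : 2 ≤ p) (hs : s ≤ 1 / 2) :
    (p : ℝ) ^ (s - 1) ≤ 3 / 4 := by
  have hp' : (2 : ℝ) ≤ p := by exact_mod_cast hp
  calc (p : ℝ) ^ (s - 1) ≤ (2 : ℝ) ^ (s - 1) :=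
        Real.rpow_le_rpow_of_nonpos two_pos hp' (by linarith)
    _ ≤ (2 : ℝ) ^ (-(1 / 2) : ℝ) := Real.rpow_le_rpow_of_exponent_le one_le_two (by linarith)
    _ ≤ 3 / 4 := by
        rw [Real.rpow_neg two_pos.le, ← Real.sqrt_eq_rpow]
        have : (4 / 3 : ℝ) ≤ √2 := Real.le_sqrt_of_sq_le (by norm_num)
        exact (inv_anti₀ (by norm_num) this).trans (by norm_num)

theorem inv_one_sub_le_exp {u : ℝ} (h0 : 0 ≤ u) (h1 : u ≤ 3 / 4) : (1 - u)⁻¹ ≤ Real.exp (4 * u) := by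
  have h2 : 0 < 1 - u := by linarith
  calc (1 - u)⁻¹ = u / (1 - u) + 1 := by field_simp; ring
    _ ≤ Real.exp (u / (1 - u)) := Real.add_one_le_exp _
    _ ≤ Real.exp (4 * u) := by
        gcongr
        rw [div_le_iff₀ h2]
        nlinarith

theorem sum_factoredNumbers_rpow_le {P U : Finset ℕ} {s : ℝ} (hs : s ≤ 1 / 2)
    (hP : ∀ p ∈ P, p.Prime) (hU : ∀ d ∈ U, d ∈ Nat.factoredNumbers P) :
    ∑ d ∈ U, (d : ℝ) ^ (s - 1) ≤ Real.exp (4 * ∑ p ∈ P, (p : ℝ) ^ (s - 1)) := by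
  have hnorm : ∀ {p : ℕ}, p.Prime → ‖rpowHom s p‖ < 1 := fun {p} hp => by
    have : rpowHom s p = (p : ℝ) ^ (s - 1) := rfl
    rw [this, Real.norm_of_nonneg (by positivity)]
    exact (rpow_sub_one_le hp.two_le hs).trans_lt (by norm_num)
  obtain ⟨-, h2⟩ :=
    EulerProduct.summable_and_hasSum_factoredNumbers_prod_filter_prime_geometric hnorm P
  have h3 : ∑ d ∈ U, (d : ℝ) ^ (s - 1) ≤ ∏ p ∈ P with p.Prime, (1 - rpowHom s p)⁻¹ := by
    have h4 := sum_le_hasSum (U.subtype (· ∈ Nat.factoredNumbers P))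
      (fun d _ => show 0 ≤ rpowHom s d from Real.rpow_nonneg (Nat.cast_nonneg _) _) h2
    rw [Finset.sum_subtype_eq_sum_filter (f := fun d => rpowHom s d),
      Finset.filter_true_of_mem hU] at h4
    exact h4
  refine h3.trans ?_
  rw [Finset.filter_true_of_mem hP, Finset.mul_sum, Real.exp_sum]
  refine Finset.prod_le_prod (fun p hp => ?_) fun p hp => ?_
  · have := hnorm (hP p hp)
    rw [inv_nonneg]
    linarith [(abs_lt.1 this).2]
  · exact inv_one_sub_le_exp (Real.rpow_nonneg (Nat.cast_nonneg _) _)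
      (rpow_sub_one_le (hP p hp).two_le hs)

theorem sum_divisors_rpow_le {f : ℕ} {s : ℝ} (hf : f ≠ 0) (hs : s ≤ 1 / 2) :
    ∑ g ∈ f.divisors, (g : ℝ) ^ (s - 1) ≤
      Real.exp (4 * ∑ q ∈ f.primeFactors, (q : ℝ) ^ (s - 1)) :=
  sum_factoredNumbers_rpow_le hs (fun _ => Nat.prime_of_mem_primeFactors) fun _ hg =>
    Nat.mem_factoredNumbers_of_primeFactors_subset (Nat.pos_of_mem_divisors hg).ne'
      (Nat.primeFactors_mono (Nat.dvd_of_mem_divisors hg) hf)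

/-- If `predLcm d = f`, every prime factor of `d` is `g + 1` with `g ∣ f`. The Euler product over
these primes bounds the sum, and `(g + 1) ^ (s - 1) ≤ g ^ (s - 1)`. -/
theorem sum_predLcm_eq_rpow_le {f : ℕ} {s : ℝ} {U : Finset ℕ} (hf : f ≠ 0) (hs : s ≤ 1 / 2)
    (hU : ∀ d ∈ U, d ≠ 0 ∧ predLcm d = f) :
    ∑ d ∈ U, (d : ℝ) ^ (s - 1) ≤ Real.exp (4 * ∑ g ∈ f.divisors, (g : ℝ) ^ (s - 1)) := by
  set P := (f.divisors.image Nat.succ).filter Nat.Prime with hPdef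
  have h1 := sum_factoredNumbers_rpow_le (P := P) (U := U) hs
    (fun p hp => (Finset.mem_filter.1 hp).2) fun d hd => by
      obtain ⟨h0, h1⟩ := hU d hd
      refine Nat.mem_factoredNumbers_of_primeFactors_subset h0 fun p hp => ?_
      have hp' := Nat.prime_of_mem_primeFactors hp
      have h2 := ((predLcm_dvd_iff h0 hf).1 h1.dvd).2 p hp' (Nat.dvd_of_mem_primeFactors hp)
      refine Finset.mem_filter.2 ⟨Finset.mem_image.2 ⟨p - 1, Nat.mem_divisors.2 ⟨h2, hf⟩, ?_⟩, hp'⟩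
      exact Nat.sub_add_cancel hp'.one_le
  refine h1.trans (Real.exp_le_exp.2 (mul_le_mul_of_nonneg_left ?_ (by norm_num)))
  calc ∑ p ∈ P, (p : ℝ) ^ (s - 1) ≤ ∑ p ∈ f.divisors.image Nat.succ, (p : ℝ) ^ (s - 1) :=
        Finset.sum_le_sum_of_subset_of_nonneg (Finset.filter_subset _ _) fun p _ _ => by positivity
    _ = ∑ g ∈ f.divisors, ((g + 1 : ℕ) : ℝ) ^ (s - 1) := Finset.sum_image (by simp)
    _ ≤ _ := Finset.sum_le_sum fun g hg => by
        refine Real.rpow_le_rpow_of_nonpos ?_ (by push_cast; linarith) (by linarith)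
        exact_mod_cast Nat.pos_of_mem_divisors hg

theorem sum_inv_Icc_le (D : ℕ) : ∑ d ∈ Finset.Icc 1 D, (d : ℝ)⁻¹ ≤ 1 + Real.log D := by
  have := harmonic_le_one_add_log D
  rwa [harmonic_eq_sum_Icc, Rat.cast_sum, Finset.sum_congr rfl fun i _ => Rat.cast_inv_nat i] at this

/-- A bound by Rankin's method for the sum of the `1 / (d * predLcm d)` over large `d`. -/
theorem sum_inv_mul_predLcm_le {D J : ℕ} {s z : ℝ} {U : Finset ℕ} (h0 : 0 ≤ s) (hs : s ≤ 1 / 2)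
    (hz : 0 < z) (hDJ : D < 2 ^ 2 ^ J)
    (hU : ∀ d ∈ U, d ∈ Finset.Icc 1 D ∧ predLcm d ≠ 0 ∧ z ≤ d) :
    ∑ d ∈ U, ((d : ℝ) * predLcm d)⁻¹ ≤ z ^ (-s) * (1 + Real.log D) * Real.exp (4 * Real.exp (4 *
      (((2 : ℝ) ^ J) ^ s * (4 * (1 + Real.log J) + 1)))) := by
  set G := Real.exp (4 * Real.exp (4 * (((2 : ℝ) ^ J) ^ s * (4 * (1 + Real.log J) + 1)))) with hG
  have hmaps : ∀ d ∈ U, predLcm d ∈ Finset.Icc 1 D := fun d hd => by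
    obtain ⟨h1, h2, h3⟩ := hU d hd
    rw [Finset.mem_Icc] at h1 ⊢
    have := predLcm_le (a := d) (by lia)
    lia
  have hterm : ∀ d ∈ U, ((d : ℝ) * predLcm d)⁻¹ ≤
      z ^ (-s) * ((predLcm d : ℝ)⁻¹ * (d : ℝ) ^ (s - 1)) := fun d hd => by
    obtain ⟨h1, h2, h3⟩ := hU d hd
    have hd0 : (0 : ℝ) < d := hz.trans_le h3
    have h4 : (d : ℝ)⁻¹ ≤ z ^ (-s) * (d : ℝ) ^ (s - 1) := by
      calc (d : ℝ)⁻¹ = (d : ℝ) ^ (-s) * (d : ℝ) ^ (s - 1) := by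
            rw [← Real.rpow_add hd0, ← Real.rpow_neg_one]
            ring_nf
        _ ≤ _ := by
            gcongr ?_ * _
            exact Real.rpow_le_rpow_of_nonpos hz h3 (by linarith)
    calc ((d : ℝ) * predLcm d)⁻¹ = (predLcm d : ℝ)⁻¹ * (d : ℝ)⁻¹ := by rw [mul_inv, mul_comm]
      _ ≤ (predLcm d : ℝ)⁻¹ * (z ^ (-s) * (d : ℝ) ^ (s - 1)) := by gcongr
      _ = _ := by ring
  calc _ ≤ ∑ d ∈ U, z ^ (-s) * ((predLcm d : ℝ)⁻¹ * (d : ℝ) ^ (s - 1)) := Finset.sum_le_sum hterm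
    -- After Rankin's trick the integers are grouped by the value `f` of `predLcm`; each group has a
    -- bound `G` independent of `f`.
    _ = z ^ (-s) * ∑ f ∈ Finset.Icc 1 D, ∑ d ∈ U with predLcm d = f,
          (predLcm d : ℝ)⁻¹ * (d : ℝ) ^ (s - 1) := by
        rw [Finset.sum_fiberwise_of_maps_to hmaps, Finset.mul_sum]
    _ ≤ z ^ (-s) * ∑ f ∈ Finset.Icc 1 D, (f : ℝ)⁻¹ * G := by
        gcongr with f hf
        rw [Finset.mem_Icc] at hf
        have hf0 : f ≠ 0 := by lia
        calc _ = ∑ d ∈ U with predLcm d = f, (f : ℝ)⁻¹ * (d : ℝ) ^ (s - 1) :=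
              Finset.sum_congr rfl fun d hd => by rw [(Finset.mem_filter.1 hd).2]
          _ = (f : ℝ)⁻¹ * ∑ d ∈ U with predLcm d = f, (d : ℝ) ^ (s - 1) := by rw [Finset.mul_sum]
          _ ≤ (f : ℝ)⁻¹ * G := by
              gcongr
              refine (sum_predLcm_eq_rpow_le hf0 hs fun d hd => ?_).trans ?_
              · obtain ⟨h1, h2⟩ := Finset.mem_filter.1 hd
                have := (Finset.mem_Icc.1 (hU d h1).1).1
                exact ⟨by lia, h2⟩
              · rw [hG]
                gcongr
                refine (sum_divisors_rpow_le hf0 hs).trans ?_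
                gcongr
                exact sum_primeFactors_rpow_le hf0 (hf.2.trans_lt hDJ) h0 (by linarith)
    _ = z ^ (-s) * (∑ f ∈ Finset.Icc 1 D, (f : ℝ)⁻¹) * G := by rw [← Finset.sum_mul, mul_assoc]
    _ ≤ _ := by
        gcongr
        exact sum_inv_Icc_le D

/-- The bound for the sums over the integers with a given value of `predLcm`. -/
noncomputable def rankinFactor (s : ℝ) (J : ℕ) : ℝ :=
  Real.exp (4 * Real.exp (4 * (((2 : ℝ) ^ J) ^ s * (4 * (1 + Real.log J) + 1))))

/-! ### The running time in terms of the threshold. -/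

theorem one_le_size {B : ℕ} (hB : B ≠ 0) : 1 ≤ B.size := Nat.size_pos.2 (Nat.pos_of_ne_zero hB)

theorem opBound_size_le {B : ℕ} (hB : B ≠ 0) : (opBound B).size + 1 ≤ 16 * B.size := by
  have h1 := one_le_size hB
  have h2 : (opBound B).size ≤ 2 * (B.size + 6) := by
    rw [Nat.size_le, opBound, mul_comm 2, pow_mul]
    refine Nat.pow_lt_pow_left ?_ two_ne_zero
    have h3 := Nat.lt_size_self B
    have h4 : 2 ≤ 2 ^ B.size := Nat.le_self_pow (by lia) 2
    rw [pow_add]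
    lia
  lia

theorem tableSize_le_two_pow (B : ℕ) : tableSize B ≤ 2 ^ B.size :=
  (tableSize_le B).trans (Nat.lt_size_self B)

theorem tableSize_pos (B : ℕ) : 1 ≤ tableSize B := Nat.le_add_left _ _

theorem tableSize_mul_threshold_le {B : ℕ} (hB : B ≠ 0) :
    (tableSize B : ℝ) ≤ 2 * B / threshold B := by
  have hT : (0 : ℝ) < threshold B := by exact_mod_cast threshold_pos B
  have hTB : (threshold B : ℝ) ≤ B := by
    exact_mod_cast (Nat.le_self_pow three_ne_zero _).trans (threshold_pow_three_le hB)
  have h1 : (1 : ℝ) ≤ B / threshold B := (one_le_div hT).2 hTB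
  have h2 : ((B / threshold B : ℕ) : ℝ) ≤ B / threshold B := Nat.cast_div_le
  rw [tableSize, mul_div_assoc]
  push_cast
  linarith

theorem one_add_log_tableSize_le {B : ℕ} (hB : B ≠ 0) :
    1 + Real.log (tableSize B) ≤ 2 * B.size := by
  have h1 : (1 : ℝ) ≤ B.size := by exact_mod_cast one_le_size hB
  have h2 : (tableSize B : ℝ) ≤ 2 ^ B.size := by exact_mod_cast tableSize_le_two_pow B
  have h3 := Real.log_le_log (by exact_mod_cast tableSize_pos B) h2
  rw [Real.log_pow] at h3
  have := Real.log_two_lt_d9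
  nlinarith

open Classical in
theorem sum_searched_le {B : ℕ} {s : ℝ} (h0 : 0 ≤ s) (hs : s ≤ 1 / 2) :
    ∑ d ∈ Finset.Ico 2 (tableSize B + 1) with Searched B d, ((d : ℝ) * predLcm d)⁻¹ ≤
      (1 + Real.log (tableSize B)) * ((threshold B : ℝ)⁻¹ +
        ((tableSize B : ℝ) / threshold B) ^ (-s) * rankinFactor s B.size.size) := by
  have hT : (0 : ℝ) < threshold B := by exact_mod_cast threshold_pos B
  have hD : (0 : ℝ) < tableSize B := by exact_mod_cast tableSize_pos B
  set U := (Finset.Ico 2 (tableSize B + 1)).filter (Searched B) with hU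
  have hUmem : ∀ d ∈ U, d ∈ Finset.Icc 1 (tableSize B) ∧ Searched B d := fun d hd => by
    simp only [hU, Finset.mem_filter, Finset.mem_Ico, Finset.mem_Icc] at hd ⊢
    exact ⟨by lia, hd.2⟩
  rw [← Finset.sum_filter_add_sum_filter_not U (fun d => threshold B ≤ predLcm d), mul_add]
  refine add_le_add ?_ ?_
  · calc _ ≤ ∑ d ∈ U with threshold B ≤ predLcm d, (d : ℝ)⁻¹ * (threshold B : ℝ)⁻¹ := by
          refine Finset.sum_le_sum fun d hd => ?_
          rw [mul_inv]
          have : (threshold B : ℝ) ≤ predLcm d := by exact_mod_cast (Finset.mem_filter.1 hd).2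
          gcongr
      _ = (∑ d ∈ U with threshold B ≤ predLcm d, (d : ℝ)⁻¹) * (threshold B : ℝ)⁻¹ := by
          rw [Finset.sum_mul]
      _ ≤ (∑ d ∈ Finset.Icc 1 (tableSize B), (d : ℝ)⁻¹) * (threshold B : ℝ)⁻¹ := by
          gcongr
          exact fun d hd => (hUmem d (Finset.mem_filter.1 hd).1).1
      _ ≤ _ := by
          gcongr
          exact sum_inv_Icc_le _
  · refine (sum_inv_mul_predLcm_le (D := tableSize B) (J := B.size.size) h0 hs
      (z := (tableSize B : ℝ) / threshold B) (by positivity) ?_ fun d hd => ?_).trans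
      (le_of_eq ?_)
    · exact (tableSize_le_two_pow B).trans_lt
        (Nat.pow_lt_pow_right one_lt_two (Nat.lt_size_self _))
    · obtain ⟨h1, h2⟩ := Finset.mem_filter.1 hd
      obtain ⟨h3, h4, h5⟩ := hUmem d h1
      refine ⟨h3, h4, ?_⟩
      rw [div_le_iff₀ hT]
      exact_mod_cast (h5.resolve_right h2).le
    · rw [rankinFactor]
      ring

namespace RAMProg

theorem sieveTime_le (B : ℕ) : (sieveTime B : ℝ) ≤
    21 * tableSize B + 22 * ((opBound B).size + 1) * tableSize B *
      (1 + Real.log (tableSize B)) := by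
  have hD1 : (1 : ℝ) ≤ tableSize B := by exact_mod_cast tableSize_pos B
  have h1 : ∑ p ∈ Finset.Ico 2 (tableSize B + 1), ((tableSize B / p : ℕ) : ℝ) ≤
      tableSize B * (1 + Real.log (tableSize B)) := by
    calc _ ≤ ∑ p ∈ Finset.Ico 2 (tableSize B + 1), tableSize B * (p : ℝ)⁻¹ := by
          gcongr with p hp
          exact Nat.cast_div_le.trans (div_eq_mul_inv _ _).le
      _ ≤ ∑ p ∈ Finset.Icc 1 (tableSize B), tableSize B * (p : ℝ)⁻¹ := by
          refine Finset.sum_le_sum_of_subset_of_nonneg (fun p hp => ?_) fun p _ _ => by positivity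
          rw [Finset.mem_Ico] at hp
          rw [Finset.mem_Icc]
          lia
      _ ≤ _ := by
          rw [← Finset.mul_sum]
          gcongr
          exact sum_inv_Icc_le _
  have h2 : ((Finset.Ico 2 (tableSize B + 1)).card : ℝ) ≤ tableSize B := by
    rw [Nat.card_Ico]
    exact_mod_cast (by lia)
  have h3 : (0 : ℝ) ≤ (opBound B).size := by positivity
  rw [sieveTime]
  push_cast
  rw [Finset.sum_add_distrib, ← Finset.mul_sum, Finset.sum_const, nsmul_eq_mul]
  have h4 := mul_le_mul_of_nonneg_left h1 (show (0 : ℝ) ≤ 11 * (opBound B).size + 22 by positivity)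
  have h5 : (0 : ℝ) ≤ ∑ p ∈ Finset.Ico 2 (tableSize B + 1), ((tableSize B / p : ℕ) : ℝ) :=
    Finset.sum_nonneg fun _ _ => by positivity
  nlinarith [h5.trans h1]

open Classical in
theorem sum_rowTime_le (B : ℕ) :
    ((∑ d ∈ Finset.Ico 2 (tableSize B + 1), (rowTime B d + 1) : ℕ) : ℝ) ≤
    24 * tableSize B + 34 * ((opBound B).size + 1) * (2 * tableSize B +
      B * ∑ d ∈ Finset.Ico 2 (tableSize B + 1) with Searched B d, ((d : ℝ) * predLcm d)⁻¹) := by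
  have h2 : ((Finset.Ico 2 (tableSize B + 1)).card : ℝ) ≤ tableSize B := by
    rw [Nat.card_Ico]
    exact_mod_cast (by lia)
  have h1 : ∀ d, ((rowTime B d + 1 : ℕ) : ℝ) ≤ (24 + 34 * ((opBound B).size + 1) * 2) +
      34 * ((opBound B).size + 1) * B *
        (if Searched B d then ((d : ℝ) * predLcm d)⁻¹ else 0) := fun d => by
    unfold rowTime
    split_ifs with h
    · have h3 : ((B / (d * predLcm d) : ℕ) : ℝ) ≤ B * ((d : ℝ) * predLcm d)⁻¹ :=
        Nat.cast_div_le.trans (by push_cast; rw [div_eq_mul_inv])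
      push_cast
      have h4 : (0 : ℝ) ≤ (opBound B).size := by positivity
      have h5 : (0 : ℝ) ≤ B * ((d : ℝ) * predLcm d)⁻¹ := by positivity
      nlinarith
    · push_cast
      have h4 : (0 : ℝ) ≤ (opBound B).size := by positivity
      linarith
  rw [Nat.cast_sum]
  refine (Finset.sum_le_sum fun d _ => h1 d).trans ?_
  rw [Finset.sum_add_distrib, ← Finset.mul_sum, ← Finset.sum_filter, Finset.sum_const, nsmul_eq_mul]
  have h4 : (0 : ℝ) ≤ 24 + 34 * ((opBound B).size + 1) * 2 := by positivity
  have h5 := mul_le_mul_of_nonneg_right h2 h4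
  linarith

/-- The power `B.size ^ 4` comes from the cost of an instruction (2), the Euclidean algorithm (1)
and a harmonic sum (1). The table, of length at most `2 * B / T`, is absorbed by the first summand.
-/
theorem listTime_mul_le {B : ℕ} {s : ℝ} (hB : B ≠ 0) (h0 : 0 ≤ s) (hs : s ≤ 1 / 2) :
    ((listTime B * ((opBound B).size + 1) ^ 2 : ℕ) : ℝ) ≤ 2 ^ 24 * (B.size : ℝ) ^ 4 * B *
      ((threshold B : ℝ)⁻¹ +
        ((tableSize B : ℝ) / threshold B) ^ (-s) * rankinFactor s B.size.size) := by
  have hT : (0 : ℝ) < threshold B := by exact_mod_cast threshold_pos B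
  have hD1 : (1 : ℝ) ≤ tableSize B := by exact_mod_cast tableSize_pos B
  have hS : ((opBound B).size : ℝ) + 1 ≤ 16 * B.size := by exact_mod_cast opBound_size_le hB
  have hD := tableSize_mul_threshold_le hB
  have hH := one_add_log_tableSize_le hB
  have hsum := sum_searched_le (B := B) h0 hs
  have h1 := sieveTime_le B
  have h2 := sum_rowTime_le B
  have hH1 : 1 ≤ 1 + Real.log (tableSize B) := by linarith [Real.log_nonneg hD1]
  set S : ℝ := ((opBound B).size : ℝ) with hSdef
  set D : ℝ := (tableSize B : ℝ) with hDdef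
  set H : ℝ := 1 + Real.log D with hHdef
  set R : ℝ := (D / threshold B) ^ (-s) * rankinFactor s B.size.size with hRdef
  have hR : 0 ≤ R :=
    mul_nonneg (Real.rpow_nonneg (div_nonneg (by linarith) hT.le) _) (Real.exp_pos _).le
  have hS0 : 0 ≤ S := Nat.cast_nonneg _
  have hDB : D ≤ B * (2 * (threshold B : ℝ)⁻¹) := by
    rw [div_eq_mul_inv] at hD
    linarith
  have hB0 : (0 : ℝ) ≤ B := Nat.cast_nonneg _
  have hT' : 0 ≤ (threshold B : ℝ)⁻¹ := by positivity
  have hDH : D ≤ D * H := le_mul_of_one_le_right (by linarith) hH1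
  have hBS := mul_le_mul_of_nonneg_left hsum hB0
  have hlist : (listTime B : ℝ) ≤ 200 * (S + 1) * (D * H + B * (H * ((threshold B : ℝ)⁻¹ + R))) := by
    have h3 : 0 ≤ B * (H * ((threshold B : ℝ)⁻¹ + R)) := by positivity
    rw [listTime]
    push_cast at h2 ⊢
    rw [← hSdef]
    set X := B * (H * ((threshold B : ℝ)⁻¹ + R))
    have h4 : 2 * D + B * _ ≤ 2 * (D * H) + X := add_le_add (by linarith) hBS
    have h5 := mul_le_mul_of_nonneg_left h4 (show 0 ≤ 34 * (S + 1) by positivity)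
    have h6 : D * H ≤ (S + 1) * (D * H) := le_mul_of_one_le_left (by linarith) (by linarith)
    have h7 : S + 1 ≤ (S + 1) * (D * H) := le_mul_of_one_le_right (by linarith) (by linarith)
    have h8 : 0 ≤ (S + 1) * X := by positivity
    nlinarith
  have hlist2 : (listTime B : ℝ) ≤ 600 * (S + 1) * H * (B * ((threshold B : ℝ)⁻¹ + R)) := by
    have h3 : D * H ≤ B * (2 * (threshold B : ℝ)⁻¹) * H := by gcongr
    refine hlist.trans ?_
    have h4 : D * H + B * (H * ((threshold B : ℝ)⁻¹ + R)) ≤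
        3 * (H * (B * ((threshold B : ℝ)⁻¹ + R))) := by
      have : 0 ≤ B * H * R := by positivity
      nlinarith
    have h5 := mul_le_mul_of_nonneg_left h4 (show 0 ≤ 200 * (S + 1) by positivity)
    linarith
  push_cast
  rw [← hSdef]
  calc (listTime B : ℝ) * (S + 1) ^ 2
      ≤ (600 * (16 * B.size) * (2 * B.size) * (B * ((threshold B : ℝ)⁻¹ + R))) *
        (16 * B.size) ^ 2 := by
        gcongr
        refine hlist2.trans ?_
        gcongr
    _ = 4915200 * ((B.size : ℝ) ^ 4 * B * ((threshold B : ℝ)⁻¹ + R)) := by ring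
    _ ≤ 2 ^ 24 * ((B.size : ℝ) ^ 4 * B * ((threshold B : ℝ)⁻¹ + R)) := by
        gcongr
        norm_num
    _ = _ := by ring

end RAMProg

/-! ### Asymptotics: comparison with `carmichaelL`. -/

open Filter

theorem tendsto_size_atTop : Tendsto Nat.size atTop atTop :=
  tendsto_atTop.2 fun b => (eventually_ge_atTop (2 ^ b)).mono fun _ hn => (Nat.lt_size.2 hn).le

theorem two_pow_size_le {n : ℕ} (hn : n ≠ 0) : (2 : ℝ) ^ n.size ≤ 2 * n := by
  have h1 := one_le_size hn
  have h2 : 2 ^ (n.size - 1) ≤ n := Nat.lt_size.1 (by lia)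
  have h3 : 2 ^ n.size = 2 * 2 ^ (n.size - 1) := by
    rw [← pow_succ']
    congr 1
    lia
  have h4 : 2 ^ n.size ≤ 2 * n := by lia
  exact_mod_cast h4

theorem lt_two_pow_size (n : ℕ) : (n : ℝ) < 2 ^ n.size := by
  exact_mod_cast Nat.lt_size_self n

theorem eventually_log_le_rpow {η C : ℝ} (hη : 0 < η) :
    ∀ᶠ n : ℕ in atTop, C * (1 + Real.log n) ≤ (n : ℝ) ^ η := by
  have h1 : (fun x : ℝ => C * (1 + Real.log x)) =o[atTop] fun x : ℝ => x ^ η :=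
    (((Asymptotics.isLittleO_const_left.2 (.inr
      (tendsto_norm_atTop_atTop.comp (tendsto_rpow_atTop hη)))).add
        (isLittleO_log_rpow_atTop hη)).const_mul_left C)
  have h2 := tendsto_natCast_atTop_atTop.eventually (h1.bound one_pos)
  filter_upwards [h2] with n hn
  rw [one_mul, Real.norm_of_nonneg (Real.rpow_nonneg (Nat.cast_nonneg n) η)] at hn
  exact (le_abs_self _).trans hn

theorem eventually_size_le {η : ℝ} (hη : 0 < η) : ∀ᶠ n : ℕ in atTop, (n.size : ℝ) ≤ η * n := by
  filter_upwards [eventually_log_le_rpow (C := 2 / η) one_pos, eventually_ne_atTop 0] with n h1 h2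
  rw [Real.rpow_one, div_mul_eq_mul_div, div_le_iff₀ hη] at h1
  have hn : (0 : ℝ) < n := by exact_mod_cast Nat.pos_of_ne_zero h2
  have h3 := Real.log_le_log (by positivity) (two_pow_size_le h2)
  rw [Real.log_pow, Real.log_mul two_ne_zero hn.ne'] at h3
  have h4 := Real.log_two_gt_d9
  have h5 := Real.log_two_lt_d9
  have h6 : (0 : ℝ) ≤ n.size := Nat.cast_nonneg _
  have h7 : 0 ≤ Real.log n := Real.log_natCast_nonneg n
  nlinarith

theorem two_pow_mul_rpow {n : ℕ} (hn : n ≠ 0) (x : ℝ) :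
    ((2 : ℝ) ^ n) ^ (x / n) = (2 : ℝ) ^ x := by
  have hn' : (n : ℝ) ≠ 0 := by exact_mod_cast hn
  rw [← Real.rpow_natCast, ← Real.rpow_mul two_pos.le, mul_div_cancel₀ _ hn']

/-- With this `s` the power is `(2 ^ n.size) ^ (1 - η) ≤ 2 * n ^ (1 - η)`; the spare `n ^ η` absorbs
`log n`. -/
theorem eventually_rankin_exponent_le {η : ℝ} (hη : 0 < η) (hη1 : η ≤ 1) :
    ∀ᶠ n : ℕ in atTop, 4 * (((2 : ℝ) ^ n) ^ ((1 - η) * n.size / n) *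
      (4 * (1 + Real.log n) + 1)) ≤ n / 4 := by
  filter_upwards [eventually_log_le_rpow (C := 160) hη, eventually_ne_atTop 0] with n h1 h2
  have hn : (0 : ℝ) < n := by exact_mod_cast Nat.pos_of_ne_zero h2
  have h3 : ((2 : ℝ) ^ n) ^ ((1 - η) * n.size / n) ≤ 2 * (n : ℝ) ^ (1 - η) := by
    rw [two_pow_mul_rpow h2, mul_comm (1 - η), Real.rpow_mul two_pos.le, Real.rpow_natCast]
    calc ((2 : ℝ) ^ n.size) ^ (1 - η) ≤ (2 * n) ^ (1 - η) := by
          have := two_pow_size_le h2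
          gcongr
      _ = 2 ^ (1 - η) * (n : ℝ) ^ (1 - η) := Real.mul_rpow two_pos.le hn.le
      _ ≤ 2 ^ (1 : ℝ) * (n : ℝ) ^ (1 - η) := by
          gcongr
          · exact one_le_two
          · linarith
      _ = _ := by rw [Real.rpow_one]
  have h7 : 0 ≤ Real.log n := Real.log_natCast_nonneg n
  calc _ ≤ 4 * (2 * (n : ℝ) ^ (1 - η) * (5 * (1 + Real.log n))) := by
        gcongr
        linarith
    _ = (n : ℝ) ^ (1 - η) * (160 * (1 + Real.log n)) / 4 := by ring
    _ ≤ (n : ℝ) ^ (1 - η) * (n : ℝ) ^ η / 4 := by gcongr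
    _ = n / 4 := by
        rw [← Real.rpow_add hn]
        simp

/-- Since `1 / 2 < log 2`, `exp (n / 4) ^ 2 ≤ 2 ^ n`, so a factor `exp (n / 4)` is left to beat `16
* n / η`. -/
theorem eventually_exp_le_two_pow {η : ℝ} (hη : 0 < η) :
    ∀ᶠ n : ℕ in atTop, 8 * Real.exp (n / 4) ≤ η * (2 ^ n / (2 * n)) := by
  filter_upwards [tendsto_natCast_atTop_atTop.eventually_ge_atTop (512 / η),
    eventually_ne_atTop 0] with n h1 h2
  have hn : (0 : ℝ) < n := by exact_mod_cast Nat.pos_of_ne_zero h2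
  rw [div_le_iff₀ hη] at h1
  have h3 := Real.quadratic_le_exp_of_nonneg (x := (n : ℝ) / 4) (by positivity)
  have h4 : Real.exp (n / 4) * Real.exp (n / 4) ≤ 2 ^ n := by
    rw [← Real.exp_add, ← Real.exp_log two_pos, ← Real.exp_nat_mul, Real.exp_le_exp]
    have := Real.log_two_gt_d9
    nlinarith
  have h5 : 16 * n ≤ η * Real.exp (n / 4) := by
    calc 16 * (n : ℝ) = n * 512 / 32 := by ring
      _ ≤ n * (n * η) / 32 := by gcongr
      _ = η * ((n / 4) ^ 2 / 2) := by ring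
      _ ≤ _ := by
          gcongr
          nlinarith
  rw [← mul_div_assoc, le_div_iff₀ (by positivity)]
  have h6 := Real.exp_pos (n / 4 : ℝ)
  calc 8 * Real.exp (n / 4) * (2 * n) = Real.exp (n / 4) * (16 * n) := by ring
    _ ≤ Real.exp (n / 4) * (η * Real.exp (n / 4)) := by gcongr
    _ = η * (Real.exp (n / 4) * Real.exp (n / 4)) := by ring
    _ ≤ _ := by gcongr

theorem exponent_carmichaelL_bounds {B : ℕ} (hn : 5 ≤ B.size.size) :
    0 ≤ Real.log B * Real.log (Real.log (Real.log B)) / Real.log (Real.log B) ∧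
    Real.log B * Real.log (Real.log (Real.log B)) / Real.log (Real.log B) ≤
      Real.log 2 * (B.size * B.size.size.size / (B.size.size - 3)) := by
  have hB0 : B ≠ 0 := by rintro rfl; simp at hn
  have ha0 : B.size ≠ 0 := fun h => by simp [h] at hn
  have hl := Real.log_two_gt_d9
  have hl' := Real.log_two_lt_d9
  have hB : (0 : ℝ) < B := by exact_mod_cast Nat.pos_of_ne_zero hB0
  have hn' : (5 : ℝ) ≤ B.size.size := by exact_mod_cast hn
  set a := B.size with ha
  set n := a.size with hn_def
  have hkpos : (0 : ℝ) ≤ n.size := Nat.cast_nonneg _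
  have ha1 : (2 : ℝ) ≤ a := by
    have h1 := two_pow_size_le ha0
    have h2 : (2 : ℝ) ^ 5 ≤ 2 ^ n := pow_le_pow_right₀ one_le_two hn
    linarith
  have u1 : Real.log B ≤ a * Real.log 2 := by
    rw [← Real.log_pow]
    exact Real.log_le_log hB (lt_two_pow_size B).le
  have l1 : (a : ℝ) / 4 ≤ Real.log B := by
    have h1 := Real.log_le_log (by positivity) (two_pow_size_le hB0)
    rw [Real.log_pow, Real.log_mul two_ne_zero hB.ne'] at h1
    nlinarith
  -- One unit is lost by `2 ^ (n - 1) ≤ a` and two by `a / 4 ≤ log B`.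
  have l2 : (n - 3) * Real.log 2 ≤ Real.log (Real.log B) := by
    have h1 := Real.log_le_log (by positivity) l1
    have h2 := Real.log_le_log (by positivity) (two_pow_size_le ha0)
    rw [Real.log_div (by positivity) (by norm_num), show (4 : ℝ) = 2 ^ 2 by norm_num,
      Real.log_pow] at h1
    rw [Real.log_pow, Real.log_mul two_ne_zero (by positivity)] at h2
    push_cast at h1
    linarith
  have u2 : Real.log (Real.log B) ≤ n := by
    have h1 := Real.log_le_log (by linarith : 0 < Real.log B)
      (show Real.log B ≤ 2 ^ n by nlinarith [lt_two_pow_size a])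
    rw [Real.log_pow] at h1
    nlinarith
  have h1 : 1 ≤ Real.log (Real.log B) := by nlinarith
  have u3 : Real.log (Real.log (Real.log B)) ≤ n.size * Real.log 2 := by
    rw [← Real.log_pow]
    exact Real.log_le_log (by linarith) (u2.trans (lt_two_pow_size n).le)
  have l3 := Real.log_nonneg h1
  have l1' : 0 ≤ Real.log B := by linarith
  refine ⟨by positivity, ?_⟩
  have hn3 : (0 : ℝ) < n - 3 := by linarith
  calc _ ≤ (a * Real.log 2) * (n.size * Real.log 2) / ((n - 3) * Real.log 2) := by gcongr
    _ = _ := by field_simp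

theorem le_carmichaelL_rpow {B : ℕ} {ε η : ℝ} (hn : 5 ≤ B.size.size) (hη : 0 ≤ η) (hη1 : 5 * η ≤ 1)
    (hηε : 6 * η ≤ ε) (h3 : 3 * (1 + η) ≤ η * B.size.size) :
    (2 : ℝ) ^ (-((1 - 5 * η) * (B.size * B.size.size.size / B.size.size))) ≤
      carmichaelL B ^ (-1 + ε) := by
  obtain ⟨h1, h2⟩ := exponent_carmichaelL_bounds hn
  have hn' : (5 : ℝ) ≤ B.size.size := by exact_mod_cast hn
  rw [carmichaelL, ← Real.exp_mul, Real.rpow_def_of_pos two_pos, Real.exp_le_exp]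
  set X := Real.log B * Real.log (Real.log (Real.log B)) / Real.log (Real.log B)
  set R : ℝ := B.size * B.size.size.size / B.size.size with hR
  have hR0 : 0 ≤ R := by positivity
  have h4 : (B.size * B.size.size.size / (B.size.size - 3) : ℝ) ≤ (1 + η) * R := by
    rw [hR, ← mul_div_assoc, div_le_div_iff₀ (by linarith) (by linarith)]
    have h5 : (0 : ℝ) ≤ B.size * B.size.size.size := by positivity
    have h6 : (B.size.size : ℝ) ≤ (1 + η) * (B.size.size - 3) := by linarith
    calc _ ≤ (B.size * B.size.size.size : ℝ) * ((1 + η) * (B.size.size - 3)) := by gcongr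
      _ = _ := by ring
  have hl : 0 < Real.log 2 := Real.log_pos one_lt_two
  have h5 : X ≤ Real.log 2 * ((1 + η) * R) := h2.trans (by gcongr)
  have h6 : (1 - 6 * η) * X ≤ Real.log 2 * ((1 - 5 * η) * R) := by
    rcases le_total (6 * η) 1 with h | h
    · calc (1 - 6 * η) * X ≤ (1 - 6 * η) * (Real.log 2 * ((1 + η) * R)) :=
            mul_le_mul_of_nonneg_left h5 (by linarith)
        _ = Real.log 2 * (((1 - 6 * η) * (1 + η)) * R) := by ring
        _ ≤ _ := by
            gcongr
            nlinarith
    · have : 0 ≤ Real.log 2 * ((1 - 5 * η) * R) :=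
        mul_nonneg hl.le (mul_nonneg (by linarith) hR0)
      nlinarith
  nlinarith

/-- The denominator of `thresholdExp` is at most `(1 + 4 * η) * B.size.size`, and `(1 - 4 * η) * (1
+ 4 * η) ≤ 1`; the extra 1 pays for the rounded quotient. -/
theorem inv_threshold_le {B : ℕ} {η : ℝ} (hn : B.size.size ≠ 0) (hη1 : 4 * η ≤ 1)
    (hk : (B.size.size.size : ℝ) ≤ η * B.size.size) :
    (threshold B : ℝ)⁻¹ ≤
      (2 : ℝ) ^ (1 - (1 - 4 * η) * (B.size * B.size.size.size / B.size.size : ℝ)) := by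
  have hn' : (0 : ℝ) < B.size.size := by exact_mod_cast Nat.pos_of_ne_zero hn
  set R : ℝ := B.size * B.size.size.size / B.size.size with hR
  have hR0 : 0 ≤ R := by positivity
  have h1 : (1 - 4 * η) * R ≤ B.size * B.size.size.size / (B.size.size + 4 * B.size.size.size) := by
    rw [le_div_iff₀ (by positivity)]
    calc (1 - 4 * η) * R * (B.size.size + 4 * B.size.size.size)
        ≤ (1 - 4 * η) * R * ((1 + 4 * η) * B.size.size) := by
          have : 0 ≤ (1 - 4 * η) * R := mul_nonneg (by linarith) hR0
          exact mul_le_mul_of_nonneg_left (by linarith) this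
      _ = (1 - (4 * η) ^ 2) * (R * B.size.size) := by ring
      _ ≤ 1 * (R * B.size.size) := by
          gcongr
          nlinarith
      _ = _ := by rw [hR]; field_simp
  have h2 : (B.size * B.size.size.size / (B.size.size + 4 * B.size.size.size) : ℝ) ≤
      thresholdExp B + 1 := by
    have := (Nat.lt_floor_add_one
      ((B.size * B.size.size.size : ℕ) / (B.size.size + 4 * B.size.size.size : ℕ) : ℝ)).le
    rw [Nat.floor_div_eq_div] at this
    push_cast at this
    exact_mod_cast this
  rw [threshold]
  push_cast
  rw [← Real.rpow_natCast, ← Real.rpow_neg two_pos.le]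
  exact Real.rpow_le_rpow_of_exponent_le one_le_two (by linarith)

theorem thresholdExp_le {B : ℕ} (hn : B.size.size ≠ 0) :
    (thresholdExp B : ℝ) ≤ B.size * B.size.size.size / B.size.size := by
  have hn' : (0 : ℝ) < B.size.size := by exact_mod_cast Nat.pos_of_ne_zero hn
  have h1 : thresholdExp B ≤ B.size * B.size.size.size / B.size.size :=
    Nat.div_le_div_left (by lia) (Nat.pos_of_ne_zero hn)
  calc (thresholdExp B : ℝ) ≤ ((B.size * B.size.size.size / B.size.size : ℕ) : ℝ) := by
        exact_mod_cast h1
    _ ≤ _ := by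
        refine Nat.cast_div_le.trans ?_
        push_cast
        rfl

theorem div_threshold_le_tableSize (B : ℕ) : (B : ℝ) / threshold B ≤ tableSize B := by
  have h := (Nat.lt_floor_add_one ((B : ℝ) / threshold B)).le
  rwa [Nat.floor_div_eq_div, ← Nat.cast_add_one] at h

theorem two_rpow_le_tableSize_div_threshold {B : ℕ} (hB : B ≠ 0) :
    (2 : ℝ) ^ (B.size - 1 - 2 * thresholdExp B : ℝ) ≤ (tableSize B : ℝ) / threshold B := by
  have hT : (0 : ℝ) < threshold B := by exact_mod_cast threshold_pos B
  have h := two_pow_size_le hB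
  rw [le_div_iff₀ hT]
  refine le_trans ?_ (div_threshold_le_tableSize B)
  have hT' : (threshold B : ℝ) = (2 : ℝ) ^ (thresholdExp B : ℝ) := by
    rw [threshold, Nat.cast_pow, Real.rpow_natCast, Nat.cast_ofNat]
  rw [le_div_iff₀ hT, hT', ← Real.rpow_add two_pos, ← Real.rpow_add two_pos,
    show (B.size - 1 - 2 * thresholdExp B + thresholdExp B + thresholdExp B : ℝ) = B.size - 1 by
      ring, Real.rpow_sub_one two_ne_zero, Real.rpow_natCast]
  linarith

/-- With `s = (1 - η) * k / n ≤ η`, the main term `a * s` loses `η`, and `2 * e * s`, from the two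
factors `T` in `B / T ^ 2`, loses `2 * η` more. -/
theorem tableSize_exponent_le {a n k e η : ℝ} (ha : 0 ≤ a) (hn : 0 < n) (hk0 : 1 ≤ k)
    (hη : 0 ≤ η) (hη1 : η ≤ 1) (hk : k ≤ η * n) (he : e ≤ a * k / n) :
    (a - 1 - 2 * e) * -((1 - η) * k / n) ≤ 1 - (1 - 3 * η) * (a * k / n) := by
  have hr : k / n ≤ η := (div_le_iff₀ hn).2 hk
  have hr0 : 0 ≤ k / n := by positivity
  have hs : 0 ≤ (1 - η) * k / n := by
    rw [mul_div_assoc]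
    exact mul_nonneg (by linarith) hr0
  have hs1 : (1 - η) * k / n ≤ η := by
    rw [mul_div_assoc]
    nlinarith
  have h1 : e * ((1 - η) * k / n) ≤ a * k / n * η :=
    (mul_le_mul_of_nonneg_right he hs).trans
      (mul_le_mul_of_nonneg_left hs1 (by positivity))
  calc (a - 1 - 2 * e) * -((1 - η) * k / n)
      = -((1 - η) * (a * k / n)) + (1 - η) * k / n + 2 * (e * ((1 - η) * k / n)) := by ring
    _ ≤ -((1 - η) * (a * k / n)) + 1 + 2 * (a * k / n * η) := by linarith
    _ = _ := by ring

theorem tableSize_div_threshold_rpow_le {B : ℕ} {η : ℝ} (hn : B.size.size ≠ 0) (hη : 0 ≤ η)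
    (hη1 : η ≤ 1) (hk : (B.size.size.size : ℝ) ≤ η * B.size.size) :
    ((tableSize B : ℝ) / threshold B) ^ (-((1 - η) * B.size.size.size / B.size.size)) ≤
      (2 : ℝ) ^ (1 - (1 - 3 * η) * (B.size * B.size.size.size / B.size.size : ℝ)) := by
  have hB0 : B ≠ 0 := by rintro rfl; simp at hn
  have hn' : (0 : ℝ) < B.size.size := by exact_mod_cast Nat.pos_of_ne_zero hn
  have hk1 : (1 : ℝ) ≤ B.size.size.size := by exact_mod_cast one_le_size hn
  have hs : -((1 - η) * B.size.size.size / B.size.size) ≤ 0 :=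
    neg_nonpos.2 (div_nonneg (mul_nonneg (by linarith) (by linarith)) hn'.le)
  refine (Real.rpow_le_rpow_of_nonpos (Real.rpow_pos_of_pos two_pos _)
    (two_rpow_le_tableSize_div_threshold hB0) hs).trans ?_
  rw [← Real.rpow_mul two_pos.le]
  exact Real.rpow_le_rpow_of_exponent_le one_le_two
    (tableSize_exponent_le (Nat.cast_nonneg _) hn' hk1 hη hη1 hk (thresholdExp_le hn))

theorem rankinFactor_le {n : ℕ} {s x : ℝ}
    (h : 4 * (((2 : ℝ) ^ n) ^ s * (4 * (1 + Real.log n) + 1)) ≤ n / 4)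
    (hx : 8 * Real.exp (n / 4) ≤ x) : rankinFactor s n ≤ (2 : ℝ) ^ x := by
  rw [rankinFactor, Real.rpow_def_of_pos two_pos, Real.exp_le_exp]
  have h1 := Real.exp_le_exp.2 h
  have h2 := Real.exp_pos (n / 4 : ℝ)
  have := Real.log_two_gt_d9
  nlinarith

theorem mul_two_rpow_le {b x y n η R : ℝ} (hb : 0 ≤ b) (hx : x ≤ (2 : ℝ) ^ (4 * n))
    (hx0 : 0 ≤ x) (hy : y ≤ (2 : ℝ) ^ (2 - (1 - 4 * η) * R)) (h : 26 + 4 * n ≤ η * R) :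
    2 ^ 24 * x * b * y ≤ b * (2 : ℝ) ^ (-((1 - 5 * η) * R)) := by
  have h1 : (2 : ℝ) ^ (24 : ℝ) = 2 ^ 24 := by
    rw [← Real.rpow_natCast]
    norm_num
  rw [← h1]
  calc (2 : ℝ) ^ (24 : ℝ) * x * b * y
      ≤ (2 : ℝ) ^ (24 : ℝ) * (2 : ℝ) ^ (4 * n) * b * (2 : ℝ) ^ (2 - (1 - 4 * η) * R) :=
        mul_le_mul_of_nonneg (by gcongr) hy (by positivity) (by positivity)
    _ = b * (2 : ℝ) ^ (24 + 4 * n + (2 - (1 - 4 * η) * R)) := by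
        rw [Real.rpow_add two_pos, Real.rpow_add two_pos]
        ring
    _ ≤ _ := by
        gcongr
        · exact one_le_two
        · linarith

theorem RAMProg.eventually_listTime_mul_le {ε : ℝ} (hε : 0 < ε) : ∀ᶠ B : ℕ in atTop,
    ((RAMProg.listTime B * ((opBound B).size + 1) ^ 2 : ℕ) : ℝ) ≤
      B * carmichaelL B ^ (-1 + ε) := by
  -- Of the six parts, four go to the threshold, one to the powers of `log B`, and one to the
  -- comparison with `carmichaelL`. The Rankin term loses `3 * η` and its factor `η`, which matches
  -- the four.
  set η : ℝ := min ε 1 / 6 with hη_def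
  have hη : 0 < η := by positivity
  have hηε : 6 * η ≤ ε := by
    have := min_le_left ε 1
    linarith
  have hη1 : 6 * η ≤ 1 := by
    have := min_le_right ε 1
    linarith
  have htend : Tendsto (fun B : ℕ => B.size.size) atTop atTop :=
    tendsto_size_atTop.comp tendsto_size_atTop
  have hev := (eventually_size_le hη).and <| (eventually_rankin_exponent_le hη (by linarith)).and <|
    (eventually_exp_le_two_pow hη).and <| (eventually_ge_atTop 30).and <|
    tendsto_natCast_atTop_atTop.eventually_ge_atTop (3 * (1 + η) / η)
  filter_upwards [htend.eventually hev] with B ⟨h1, h2, h3, h4, h5⟩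
  rw [div_le_iff₀ hη, mul_comm _ η] at h5
  have hn0 : B.size.size ≠ 0 := by lia
  have ha0 : B.size ≠ 0 := fun h => hn0 (by simp [h])
  have hB0 : B ≠ 0 := by rintro rfl; simp at ha0
  have hn' : (30 : ℝ) ≤ B.size.size := by exact_mod_cast h4
  have hL := le_carmichaelL_rpow (by lia) hη.le (by linarith) hηε h5
  have hT := inv_threshold_le hn0 (by linarith) h1
  have hz := tableSize_div_threshold_rpow_le hn0 hη.le (by linarith) h1
  have hapow := two_pow_size_le ha0
  have haub := lt_two_pow_size B.size
  have hk1 : (1 : ℝ) ≤ B.size.size.size := by exact_mod_cast one_le_size hn0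
  set a : ℝ := (B.size : ℝ) with ha
  set n : ℝ := (B.size.size : ℝ) with hn
  set k : ℝ := (B.size.size.size : ℝ) with hk
  -- The exponent `R` of `L(B)` is nearly as large as `log B`, so it dominates both `exp (n / 4)`
  -- and the exponent of the polylogarithmic factor.
  have hRlow : (2 : ℝ) ^ B.size.size / (2 * n) ≤ a * k / n := by
    rw [div_le_div_iff₀ (by positivity) (by positivity)]
    have h6 : (2 : ℝ) ^ B.size.size * n ≤ 2 * a * n := by gcongr
    have h7 : 2 * a * n ≤ 2 * a * n * k := le_mul_of_one_le_right (by positivity) hk1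
    linarith
  set R : ℝ := a * k / n with hR
  have hexp : 8 * Real.exp (n / 4) ≤ η * R := h3.trans (by gcongr)
  have hG := rankinFactor_le h2 hexp
  have hpoly : 26 + 4 * n ≤ η * R := by
    refine le_trans ?_ hexp
    have := Real.quadratic_le_exp_of_nonneg (x := n / 4) (by positivity)
    nlinarith
  have hs : (1 - η) * k / n ≤ 1 / 2 := by
    rw [div_le_iff₀ (by positivity)]
    nlinarith
  have hs0 : 0 ≤ (1 - η) * k / n :=
    div_nonneg (mul_nonneg (by linarith) (by linarith)) (by linarith)
  refine (RAMProg.listTime_mul_le hB0 hs0 hs).trans ?_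
  rw [← ha]
  have hR0 : 0 ≤ R := by positivity
  have hsum : (threshold B : ℝ)⁻¹ + ((tableSize B : ℝ) / threshold B) ^ (-((1 - η) * k / n)) *
      rankinFactor ((1 - η) * k / n) B.size.size ≤ (2 : ℝ) ^ (2 - (1 - 4 * η) * R) := by
    calc _ ≤ (2 : ℝ) ^ (1 - (1 - 4 * η) * R) + (2 : ℝ) ^ (1 - (1 - 3 * η) * R) * 2 ^ (η * R) := by
          gcongr
          exact (Real.exp_pos _).le
      _ = (2 : ℝ) ^ (1 - (1 - 4 * η) * R) + (2 : ℝ) ^ (1 - (1 - 4 * η) * R) := by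
          rw [← Real.rpow_add two_pos]
          ring_nf
      _ = _ := by
          rw [show 2 - (1 - 4 * η) * R = (1 - (1 - 4 * η) * R) + 1 by ring,
            Real.rpow_add_one two_ne_zero]
          ring
  have ha4 : a ^ 4 ≤ (2 : ℝ) ^ (4 * n) := by
    calc a ^ 4 ≤ ((2 : ℝ) ^ B.size.size) ^ 4 := by gcongr
      _ = _ := by
          rw [← pow_mul, ← Real.rpow_natCast]
          push_cast
          rw [mul_comm]
  exact (mul_two_rpow_le (Nat.cast_nonneg B) ha4 (by positivity) hsum hpoly).trans
    (mul_le_mul_of_nonneg_left hL (Nat.cast_nonneg B))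

/-! ### Correctness and time of the program. -/

namespace RAMProg

theorem exists_exec_carmichaelList (B : ℕ) : ∃ m' out t,
    (∀ ω, Exec carmichaelList (initMem B) ω m' ω out t) ∧
    t ≤ listTime B * ((opBound B).size + 1) ^ 2 ∧ ∀ n, n ∈ out ↔ IsCarmichael n ∧ n < B :=
  carmichaelList_spec B

theorem carmichaelList_lists : carmichaelList.ListsCarmichael := fun B => by
  obtain ⟨m, out, t, h1, -, h3⟩ := exists_exec_carmichaelList B
  refine ⟨.of_forall fun ω => ⟨m, ω, out, t, h1 ω⟩, fun ω m' ω' out' t' h => ?_⟩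
  obtain ⟨-, -, rfl, -⟩ := (h1 ω).unique h
  exact h3

theorem runTime_carmichaelList_le (B : ℕ) (ω : ℕ → Bool) :
    carmichaelList.runTime B ω ≤ ((listTime B * ((opBound B).size + 1) ^ 2 : ℕ) : ℝ≥0∞) := by
  obtain ⟨m, out, t, h1, h2, -⟩ := exists_exec_carmichaelList B
  exact (iInf₂_le t ⟨m, ω, out, h1 ω⟩).trans (by exact_mod_cast h2)

theorem exists_runTime_carmichaelList_le {ε : ℝ} (hε : 0 < ε) : ∃ B₀ : ℕ, ∀ B : ℕ, B₀ < B →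
    ∀ ω, carmichaelList.runTime B ω ≤ ENNReal.ofReal ((B : ℝ) * carmichaelL B ^ (-1 + ε)) := by
  obtain ⟨B₀, h⟩ := Filter.eventually_atTop.1 (eventually_listTime_mul_le hε)
  refine ⟨B₀, fun B hB ω => (runTime_carmichaelList_le B ω).trans ?_⟩
  rw [← ENNReal.ofReal_natCast]
  exact ENNReal.ofReal_le_ofReal (h B hB.le)

instance : IsProbabilityMeasure coinMeasure := by
  unfold coinMeasure
  infer_instance

end RAMProg

theorem mainTheorem1 :
    (∃ A : RAMProg, A.ListsCarmichael ∧
      (CarmichaelInZPP →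
        ∀ ε : ℝ, 0 < ε → ∃ B₀ : ℕ, ∀ B : ℕ, B₀ < B →
          A.expectedTime B ≤ ENNReal.ofReal ((B : ℝ) * carmichaelL B ^ (-1 + ε)))) ∧
    (∃ A : RAMProg, A.Deterministic ∧ A.ListsCarmichael ∧
      ((ExtendedRiemannHypothesis → CarmichaelInP) → ExtendedRiemannHypothesis →
        ∀ ε : ℝ, 0 < ε → ∃ B₀ : ℕ, ∀ B : ℕ, B₀ < B → ∀ ω : ℕ → Bool,
          A.runTime B ω ≤ ENNReal.ofReal ((B : ℝ) * carmichaelL B ^ (-1 + ε)))) := by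
  refine ⟨⟨RAMProg.carmichaelList, RAMProg.carmichaelList_lists, fun _ ε hε => ?_⟩,
    RAMProg.carmichaelList, RAMProg.carmichaelList_deterministic, RAMProg.carmichaelList_lists,
    fun _ _ ε hε => RAMProg.exists_runTime_carmichaelList_le hε⟩
  obtain ⟨B₀, h⟩ := RAMProg.exists_runTime_carmichaelList_le hε
  refine ⟨B₀, fun B hB => ?_⟩
  -- The bound is uniform in the coin tosses and `coinMeasure` has total mass 1.
  calc RAMProg.expectedTime RAMProg.carmichaelList B
      ≤ ∫⁻ _, ENNReal.ofReal ((B : ℝ) * carmichaelL B ^ (-1 + ε)) ∂(RAMProg.coinMeasure) :=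
        lintegral_mono fun ω => h B hB ω
    _ = _ := by simp
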